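/- Let $E=(E^0,E^1,s,r)$ be an arbitrary directed graph with $E^0\neq\varnothing$ (no finiteness or countability is assumed), and let $S$ be a commutative semiring with $1\neq 0$. A vertex $v$ is regular if $0<|s^{-1}(v)|<\infty$. Let $X_E$ be the set of all finite paths in $E$ (vertices included, as paths of length $0$) that end at a non-regular vertex, together with all infinite paths. The graph groupoid is $$\mathcal G_E=\{(\alpha x,|\alpha|-|\beta|,\beta x)\;:\;\alpha,\beta \text{ finite paths},\ x\in X_E,\ r(\alpha)=s(x)=r(\beta)\},$$ with $(x,k,y)(y,l,z)=(x,k+l,z)$ and $(x,k,y)^{-1}=(y,-k,x)$, and with the topology that has as base the sets $Z(\alpha,\beta)\setminus\bigcup_{e\in F}Z(\alpha e,\beta e)$, where $r(\alpha)=r(\beta)$, $F\subseteq s^{-1}(r(\alpha))$ is finite, and $Z(\alpha,\beta)=\{(\alpha x,|\alpha|-|\beta|,\beta x): x\in X_E,\ s(x)=r(\alpha)\}$; this is a Hausdorff ample groupoid. Its Steinberg algebra $A_S(\mathcal G_E)$ is the $S$-semimodule of functions $\mathcal G_E\to S$ generated by the characteristic functions of the compact open bisections (compact open sets on which the range map $(x,k,y)\mapsto(x,0,x)$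 and the source map $(x,k,y)\mapsto(y,0,y)$ are homeomorphisms onto open subsets of the unit space $\{(x,0,x):x\in X_E\}$), with the convolution product $(f*g)(\gamma)=\sum_{\gamma=\alpha\beta}f(\alpha)g(\beta)$. A nonzero hemiring (a semiring that need not have a multiplicative identity) is congruence-simple if its only congruences are the diagonal and the universal one. A set $H\subseteq E^0$ is hereditary if $s(e)\in H$ implies $r(e)\in H$ for all $e\in E^1$, and saturated if every regular vertex $v$ with $r(s^{-1}(v))\subseteq H$ lies in $H$. A cycle is a path $e_1\cdots e_n$ with $n\ge 1$, $r(e_n)=s(e_1)$ and $s(e_1),\dots,s(e_n)$ distinct; an exit for it is an edge $f$ with $s(f)=s(e_i)$ and $f\neq e_i$ for some $i$. Then $A_S(\mathcal G_E)$ is congruence-simple if and only if the following three conditions hold: 1. $S$ is a field, or $S$ is isomorphic to the Boolean semifield $\mathbb B=(\{0,1\},\vee,\wedge,0,1)$; 2. the only hereditary and saturated subsets of $E^0$ are $\varnothing$ and $E^0$; 3. every cycle in $E$ has an exit. -/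

import Mathlib

open CategoryTheory Topology

universe u v w

/-! ### Hausdorff ample groupoids and their Steinberg algebras -/

/-- The set of all arrows of a small groupoid with set of objects `X`. In Mathlib's order of
composition the product `αβ` of arrows is `α ≫ β`; so an arrow `x ⟶ y` has range `x`
and source `y`, and `αβ` is defined if and only if the range of `β` is the source of `α`. -/
structure Arr (X : Type u) [Groupoid.{v} X] where
  rngObj : X
  srcObj : X
  hom : rngObj ⟶ srcObj

namespace Arr

variable {X : Type u} [Groupoid.{v} X]

/-- The unit (identity arrow) at an object. -/
def one (x : X) : Arr X := ⟨x, x, 𝟙 x⟩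

/-- The inverse of an arrow. -/
def inv (α : Arr X) : Arr X := ⟨α.srcObj, α.rngObj, Groupoid.inv α.hom⟩

/-- The product of two composable arrows. -/
def comp (α β : Arr X) (h : α.srcObj = β.rngObj) : Arr X :=
  ⟨α.rngObj, β.srcObj, α.hom ≫ eqToHom h ≫ β.hom⟩

variable (X) in
/-- The unit space, as a set of arrows. -/
def unitSpace : Set (Arr X) := Set.range one

theorem one_mem_unitSpace (x : X) : one x ∈ unitSpace X := Set.mem_range_self _

/-- The source of an arrow, as a unit. -/
def source (α : Arr X) : unitSpace X := ⟨one α.srcObj, one_mem_unitSpace _⟩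

/-- The range of an arrow, as a unit. -/
def range (α : Arr X) : unitSpace X := ⟨one α.rngObj, one_mem_unitSpace _⟩

theorem one_injective : Function.Injective (one : X → Arr X) := fun _ _ h => congrArg rngObj h

theorem source_eq_iff {α β : Arr X} : α.source = β.source ↔ α.srcObj = β.srcObj :=
  Subtype.ext_iff.trans one_injective.eq_iff

theorem range_eq_iff {α β : Arr X} : α.range = β.range ↔ α.rngObj = β.rngObj :=
  Subtype.ext_iff.trans one_injective.eq_iff

theorem source_eq_range_iff {α β : Arr X} : α.source = β.range ↔ α.srcObj = β.rngObj :=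
  Subtype.ext_iff.trans one_injective.eq_iff

theorem range_eq_source_inv (α : Arr X) : α.range = α.inv.source := rfl

theorem inv_inv (α : Arr X) : α.inv.inv = α := by simp [inv]

theorem inv_comp_comp {α β : Arr X} (h : α.srcObj = β.rngObj) :
    α.inv.comp (α.comp β h) rfl = β := by
  obtain ⟨x, y, a⟩ := α
  obtain ⟨y', z, b⟩ := β
  obtain rfl : y = y' := h
  simp [comp, inv]

theorem comp_inv_comp {α γ : Arr X} (h : α.rngObj = γ.rngObj) :
    α.comp (α.inv.comp γ h) rfl = γ := by
  obtain ⟨x, y, a⟩ := α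
  obtain ⟨x', z, c⟩ := γ
  obtain rfl : x = x' := h
  simp [comp, inv]

theorem comp_assoc {α β γ : Arr X} (h : α.srcObj = β.rngObj) (h' : β.srcObj = γ.rngObj) :
    (α.comp β h).comp γ h' = α.comp (β.comp γ h') h := by
  simp [comp]

/-- The set of composable pairs. -/
def composable (X : Type u) [Groupoid.{v} X] : Set (Arr X × Arr X) :=
  {p | p.1.srcObj = p.2.rngObj}

/-- The product `UV` of two sets of arrows. -/
def setMul (U V : Set (Arr X)) : Set (Arr X) :=
  {γ | ∃ α ∈ U, ∃ β ∈ V, ∃ h : α.srcObj = β.rngObj, α.comp β h = γ}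

theorem setMul_assoc (U V W : Set (Arr X)) :
    setMul (setMul U V) W = setMul U (setMul V W) := by
  ext γ
  constructor
  · rintro ⟨_, ⟨α, hα, β, hβ, h, rfl⟩, δ, hδ, h', rfl⟩
    exact ⟨α, hα, β.comp δ h', ⟨β, hβ, δ, hδ, h', rfl⟩, h, (comp_assoc h h').symm⟩
  · rintro ⟨α, hα, _, ⟨β, hβ, δ, hδ, h', rfl⟩, h, rfl⟩
    exact ⟨α.comp β h, ⟨α, hα, β, hβ, h, rfl⟩, δ, hδ, h', comp_assoc (β := β) (γ := δ) h h'⟩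

variable [TopologicalSpace (Arr X)]

/-- An open bisection: an open set of arrows on which the source map and the range map
are homeomorphisms onto open subsets of the unit space. -/
def IsOpenBisection (U : Set (Arr X)) : Prop :=
  IsOpen U ∧ IsOpenEmbedding (U.domRestrict source) ∧ IsOpenEmbedding (U.domRestrict range)

theorem IsOpenBisection.injOn_source {U : Set (Arr X)} (hU : IsOpenBisection U) :
    Set.InjOn source U := Set.injOn_iff_injective.2 hU.2.1.injective

theorem IsOpenBisection.injOn_range {U : Set (Arr X)} (hU : IsOpenBisection U) :
    Set.InjOn range U := Set.injOn_iff_injective.2 hU.2.2.injective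

variable (X) in
/-- The collection of compact open bisections. -/
def compactOpenBisections : Set (Set (Arr X)) := {U | IsOpenBisection U ∧ IsCompact U}

end Arr

/-- Hausdorff ample groupoids: Hausdorff topological groupoids with locally compact (Hausdorff)
unit space, whose source map is a local homeomorphism, and which have a base of compact open
bisections. -/
class IsHausdorffAmple (X : Type u) [Groupoid.{v} X] [TopologicalSpace (Arr X)] : Prop where
  t2Space : T2Space (Arr X)
  continuous_inv : Continuous (Arr.inv : Arr X → Arr X)
  continuous_comp : Continuous fun p : Arr.composable X => p.1.1.comp p.1.2 p.2
  locallyCompactSpace : LocallyCompactSpace (Arr.unitSpace X)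
  isLocalHomeomorph_source : IsLocalHomeomorph (Arr.source : Arr X → Arr.unitSpace X)
  isTopologicalBasis : TopologicalSpace.IsTopologicalBasis (Arr.compactOpenBisections X)

namespace Arr

section Bisections

variable {X : Type u} [Groupoid.{v} X] [TopologicalSpace (Arr X)] [IsHausdorffAmple X]

theorem continuous_source : Continuous (source : Arr X → unitSpace X) :=
  IsHausdorffAmple.isLocalHomeomorph_source.continuous

theorem isOpenMap_source : IsOpenMap (source : Arr X → unitSpace X) :=
  IsHausdorffAmple.isLocalHomeomorph_source.isOpenMap

theorem continuous_range : Continuous (range : Arr X → unitSpace X) :=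
  continuous_source.comp IsHausdorffAmple.continuous_inv

theorem isOpenMap_range : IsOpenMap (range : Arr X → unitSpace X) := by
  have h : IsOpenMap (inv : Arr X → Arr X) := fun U hU => by
    have : inv '' U = inv ⁻¹' U := by
      ext α
      exact ⟨by rintro ⟨β, hβ, rfl⟩; simpa [inv_inv] using hβ, fun h => ⟨_, h, inv_inv _⟩⟩
    rw [this]
    exact hU.preimage IsHausdorffAmple.continuous_inv
  exact isOpenMap_source.comp h

theorem isOpenBisection_of {U : Set (Arr X)} (hU : IsOpen U)
    (hs : Set.InjOn source U) (hr : Set.InjOn range U) : IsOpenBisection U :=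
  ⟨hU, .of_continuous_injective_isOpenMap (continuous_source.comp continuous_subtype_val)
      hs.injective (isOpenMap_source.comp hU.isOpenMap_subtype_val),
    .of_continuous_injective_isOpenMap (continuous_range.comp continuous_subtype_val)
      hr.injective (isOpenMap_range.comp hU.isOpenMap_subtype_val)⟩

theorem isOpen_setMul {U V : Set (Arr X)} (hU : IsOpenBisection U) (hV : IsOpen V) :
    IsOpen (setMul U V) := by
  rw [isOpen_iff_mem_nhds]
  rintro _ ⟨α, hα, β, hβ, h, rfl⟩
  set e := @Topology.IsOpenEmbedding.toOpenPartialHomeomorph _ _ _ _ _ hU.2.2 ⟨⟨α, hα⟩⟩ with he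
  have het : e.target = Set.range (U.domRestrict range) := by simp [he]
  have hmaps (γ : Arr X) (hγ : γ.range ∈ e.target) : (e.symm γ.range : Arr X).rngObj = γ.rngObj := by
    have := e.right_inv hγ
    exact range_eq_iff.1 this
  set O : Set (Arr X) := range ⁻¹' e.target with hO
  have hOo : IsOpen O := e.open_target.preimage continuous_range
  let φ : O → Arr X := fun γ => (e.symm γ.1.range : Arr X).inv.comp γ.1 (hmaps γ.1 γ.2)
  have hφ : Continuous φ := by
    have h1 : Continuous fun γ : O => (e.symm γ.1.range : Arr X) := by
      refine continuous_subtype_val.comp ?_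
      exact e.continuousOn_symm.comp_continuous (continuous_range.comp continuous_subtype_val)
        fun γ => γ.2
    exact IsHausdorffAmple.continuous_comp.comp
      (Continuous.subtype_mk ((IsHausdorffAmple.continuous_inv.comp h1).prodMk
        continuous_subtype_val) fun γ => hmaps γ.1 γ.2)
  have hmem : α.comp β h ∈ O := by
    rw [hO, Set.mem_preimage, het]
    exact ⟨⟨α, hα⟩, rfl⟩
  have hsym : (e.symm (α.comp β h).range : Arr X) = α := by
    have hr : (e.symm (α.comp β h).range : Arr X).range = α.range := by
      rw [range_eq_iff]; exact hmaps _ hmem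
    exact hU.injOn_range (Subtype.coe_prop _) hα hr
  have hopen : IsOpen (Subtype.val '' (φ ⁻¹' V)) :=
    hOo.isOpenMap_subtype_val _ (hV.preimage hφ)
  refine Filter.mem_of_superset (hopen.mem_nhds ⟨⟨_, hmem⟩, ?_, rfl⟩) ?_
  · change (e.symm (α.comp β h).range : Arr X).inv.comp _ _ ∈ V
    have : (e.symm (α.comp β h).range : Arr X).inv.comp (α.comp β h) (hmaps _ hmem) = β := by
      generalize_proofs pf
      revert pf
      rw [hsym]
      intro _
      exact inv_comp_comp h
    rwa [this]
  · rintro _ ⟨γ, hγ, rfl⟩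
    exact ⟨_, Subtype.coe_prop (e.symm γ.1.range), _, hγ, rfl, comp_inv_comp (hmaps γ.1 γ.2)⟩

theorem isCompact_setMul {U V : Set (Arr X)} (hU : IsCompact U) (hV : IsCompact V) :
    IsCompact (setMul U V) := by
  have := IsHausdorffAmple.t2Space (X := X)
  have hcl : IsClosed (composable X) := by
    have : composable X = {p | p.1.source = p.2.range} := by
      ext p; exact source_eq_range_iff.symm
    rw [this]
    exact isClosed_eq (continuous_source.comp continuous_fst) (continuous_range.comp continuous_snd)
  have hc : IsCompact ((Subtype.val : composable X → _) ⁻¹' (U ×ˢ V)) :=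
    hcl.isClosedEmbedding_subtypeVal.isCompact_preimage (hU.prod hV)
  convert hc.image IsHausdorffAmple.continuous_comp
  ext γ
  constructor
  · rintro ⟨α, hα, β, hβ, h, rfl⟩
    exact ⟨⟨(α, β), h⟩, ⟨hα, hβ⟩, rfl⟩
  · rintro ⟨⟨⟨α, β⟩, h⟩, ⟨hα, hβ⟩, rfl⟩
    exact ⟨α, hα, β, hβ, h, rfl⟩

theorem setMul_mem {U V : Set (Arr X)} (hU : U ∈ compactOpenBisections X)
    (hV : V ∈ compactOpenBisections X) : setMul U V ∈ compactOpenBisections X := by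
  refine ⟨isOpenBisection_of (isOpen_setMul hU.1 hV.1.1) ?_ ?_, isCompact_setMul hU.2 hV.2⟩
  · rintro _ ⟨α, hα, β, hβ, h, rfl⟩ _ ⟨α', hα', β', hβ', h', rfl⟩ e
    obtain rfl : β = β' := hV.1.injOn_source hβ hβ' (source_eq_iff.2 (source_eq_iff.1 e))
    obtain rfl : α = α' := hU.1.injOn_source hα hα' (source_eq_iff.2 (h.trans h'.symm))
    rfl
  · rintro _ ⟨α, hα, β, hβ, h, rfl⟩ _ ⟨α', hα', β', hβ', h', rfl⟩ e
    obtain rfl : α = α' := hU.1.injOn_range hα hα' (range_eq_iff.2 (range_eq_iff.1 e))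
    obtain rfl : β = β' := hV.1.injOn_range hβ hβ' (range_eq_iff.2 (h.symm.trans h'))
    rfl

end Bisections

end Arr

section SteinbergAlgebra

open Arr

variable {S : Type w} [CommSemiring S] {X : Type u} [Groupoid.{v} X]

/-- The set of all factorizations `γ = αβ`. -/
abbrev Factorization (γ : Arr X) : Type max u v :=
  {p : Arr X × Arr X // ∃ h : p.1.srcObj = p.2.rngObj, p.1.comp p.2 h = γ}

/-- Convolution: `(f ∗ g)(γ)` is the sum of `f(α) g(β)` over all factorizations `γ = αβ`
(only finitely many terms are nonzero if `f` and `g` lie in the Steinberg algebra). -/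
noncomputable def convolution (f g : Arr X → S) (γ : Arr X) : S :=
  ∑ᶠ p : Factorization γ, f p.1.1 * g p.1.2

theorem Factorization.ext_fst {γ : Arr X} {p q : Factorization γ} (h : p.1.1 = q.1.1) : p = q := by
  obtain ⟨⟨α, β⟩, e, rfl⟩ := p
  obtain ⟨⟨α', β'⟩, e', h'⟩ := q
  obtain rfl : α = α' := h
  have h1 := inv_comp_comp e
  have h2 := inv_comp_comp e'
  have h3 : β = β' := by
    refine h1.symm.trans (Eq.trans ?_ h2)
    dsimp only at h' ⊢
    congr 1
    exact h'.symm
  subst h3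
  rfl

theorem Factorization.rngObj {γ : Arr X} (p : Factorization γ) : p.1.1.rngObj = γ.rngObj := by
  obtain ⟨⟨α, β⟩, e, rfl⟩ := p
  rfl

theorem convolution_zero_left (f : Arr X → S) : convolution 0 f = 0 := by
  funext γ; simp [convolution]

theorem convolution_zero_right (f : Arr X → S) : convolution f 0 = 0 := by
  funext γ; simp [convolution]

variable [TopologicalSpace (Arr X)]

variable (S X) in
/-- The `S`-semimodule of functions on the groupoid that is generated by the characteristic
functions of the compact open bisections. -/
def steinbergSubmodule : Submodule S (Arr X → S) :=
  Submodule.span S {f | ∃ U ∈ compactOpenBisections X, f = U.indicator 1}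

theorem finite_support {f : Arr X → S} (hf : f ∈ steinbergSubmodule S X) (x : X) :
    {α : Arr X | α.rngObj = x ∧ f α ≠ 0}.Finite := by
  induction hf using Submodule.span_induction with
  | mem f hf =>
    obtain ⟨U, hU, rfl⟩ := hf
    refine Set.Subsingleton.finite ?_
    rintro α ⟨rfl, hα⟩ β ⟨hβx, hβ⟩
    have hα' := Set.mem_of_indicator_ne_zero hα
    have hβ' := Set.mem_of_indicator_ne_zero hβ
    exact Set.injOn_iff_injective.2 hU.1.2.2.injective hα' hβ' (range_eq_iff.2 hβx.symm)
  | zero => simp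
  | add f g _ _ hf hg =>
    refine (hf.union hg).subset ?_
    rintro α ⟨hx, hα⟩
    by_cases h : f α = 0
    · exact Or.inr ⟨hx, fun h' => hα (by simp [h, h'])⟩
    · exact Or.inl ⟨hx, h⟩
  | smul c f _ hf =>
    exact hf.subset fun α hα => ⟨hα.1, fun h => hα.2 (by simp [h])⟩

theorem finite_support_factorization {f : Arr X → S} (hf : f ∈ steinbergSubmodule S X)
    (g : Arr X → S) (γ : Arr X) :
    (Function.support fun p : Factorization γ => f p.1.1 * g p.1.2).Finite := by
  refine Set.Finite.of_finite_image (f := fun p : Factorization γ => p.1.1)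
    ((finite_support hf γ.rngObj).subset ?_) (fun p _ q _ h => Factorization.ext_fst h)
  rintro _ ⟨p, hp, rfl⟩
  exact ⟨p.rngObj, fun h => hp (by simp [h])⟩

theorem convolution_add_right {f : Arr X → S} (hf : f ∈ steinbergSubmodule S X)
    (g h : Arr X → S) : convolution f (g + h) = convolution f g + convolution f h := by
  funext γ
  simp only [convolution, Pi.add_apply, mul_add]
  exact finsum_add_distrib (finite_support_factorization hf g γ)
    (finite_support_factorization hf h γ)

theorem convolution_add_left {f g : Arr X → S} (hf : f ∈ steinbergSubmodule S X)
    (hg : g ∈ steinbergSubmodule S X) (h : Arr X → S) :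
    convolution (f + g) h = convolution f h + convolution g h := by
  funext γ
  simp only [convolution, Pi.add_apply, add_mul]
  exact finsum_add_distrib (finite_support_factorization hf h γ)
    (finite_support_factorization hg h γ)

theorem convolution_smul_left {f : Arr X → S} (hf : f ∈ steinbergSubmodule S X) (c : S)
    (g : Arr X → S) : convolution (c • f) g = c • convolution f g := by
  funext γ
  simp only [convolution, Pi.smul_apply, smul_eq_mul, mul_assoc]
  exact (mul_finsum' _ _ (finite_support_factorization hf g γ)).symm

theorem convolution_smul_right {f : Arr X → S} (hf : f ∈ steinbergSubmodule S X) (c : S)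
    (g : Arr X → S) : convolution f (c • g) = c • convolution f g := by
  funext γ
  simp only [convolution, Pi.smul_apply, smul_eq_mul, mul_left_comm _ c]
  exact (mul_finsum' _ _ (finite_support_factorization hf g γ)).symm

theorem convolution_indicator {U V : Set (Arr X)} (hU : U ∈ compactOpenBisections X) :
    convolution (U.indicator 1) (V.indicator 1) = (setMul U V).indicator (1 : Arr X → S) := by
  classical
  funext γ
  by_cases hγ : γ ∈ setMul U V
  · rw [Set.indicator_of_mem hγ]
    obtain ⟨α, hα, β, hβ, h, rfl⟩ := hγ
    rw [convolution, finsum_eq_single _ ⟨(α, β), h, rfl⟩]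
    · simp [hα, hβ]
    · intro p hp
      by_cases h1 : p.1.1 ∈ U
      · refine absurd (Factorization.ext_fst ?_) hp
        exact Set.injOn_iff_injective.2 hU.1.2.2.injective h1 hα (range_eq_iff.2 p.rngObj)
      · simp [h1]
  · rw [Set.indicator_of_notMem hγ]
    refine finsum_eq_zero_of_forall_eq_zero fun p => ?_
    by_cases h1 : p.1.1 ∈ U
    · by_cases h2 : p.1.2 ∈ V
      · obtain ⟨h, e⟩ := p.2
        exact absurd ⟨_, h1, _, h2, h, e⟩ hγ
      · simp [h2]
    · simp [h1]

variable [IsHausdorffAmple X]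

theorem convolution_mem {f g : Arr X → S} (hf : f ∈ steinbergSubmodule S X)
    (hg : g ∈ steinbergSubmodule S X) : convolution f g ∈ steinbergSubmodule S X := by
  induction hf using Submodule.span_induction with
  | mem f hf =>
    induction hg using Submodule.span_induction with
    | mem g hg =>
      obtain ⟨U, hU, rfl⟩ := hf
      obtain ⟨V, hV, rfl⟩ := hg
      rw [convolution_indicator hU]
      exact Submodule.subset_span ⟨_, setMul_mem hU hV, rfl⟩
    | zero => rw [convolution_zero_right]; exact zero_mem _
    | add g h _ _ ihg ihh =>
      rw [convolution_add_right (Submodule.subset_span hf)]; exact add_mem ihg ihh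
    | smul c g _ ih =>
      rw [convolution_smul_right (Submodule.subset_span hf)]; exact Submodule.smul_mem _ _ ih
  | zero => rw [convolution_zero_left]; exact zero_mem _
  | add f h hf hh ihf ihh => rw [convolution_add_left hf hh]; exact add_mem ihf ihh
  | smul c f hf ih => rw [convolution_smul_left hf]; exact Submodule.smul_mem _ _ ih

theorem convolution_assoc {f g h : Arr X → S} (hf : f ∈ steinbergSubmodule S X)
    (hg : g ∈ steinbergSubmodule S X) (hh : h ∈ steinbergSubmodule S X) :
    convolution (convolution f g) h = convolution f (convolution g h) := by
  induction hf using Submodule.span_induction with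
  | mem f hf =>
    have hf' : f ∈ steinbergSubmodule S X := Submodule.subset_span hf
    induction hg using Submodule.span_induction with
    | mem g hg =>
      have hg' : g ∈ steinbergSubmodule S X := Submodule.subset_span hg
      induction hh using Submodule.span_induction with
      | mem h hh =>
        obtain ⟨U, hU, rfl⟩ := hf
        obtain ⟨V, hV, rfl⟩ := hg
        obtain ⟨W, hW, rfl⟩ := hh
        rw [convolution_indicator hU, convolution_indicator (setMul_mem hU hV),
          convolution_indicator hV, convolution_indicator hU, setMul_assoc]
      | zero => simp only [convolution_zero_right]
      | add h k _ _ ihh ihk =>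
        rw [convolution_add_right (convolution_mem hf' hg'), convolution_add_right hg',
          convolution_add_right hf', ihh, ihk]
      | smul c h _ ih =>
        rw [convolution_smul_right (convolution_mem hf' hg'), convolution_smul_right hg',
          convolution_smul_right hf', ih]
    | zero => simp only [convolution_zero_right, convolution_zero_left]
    | add g k hg hk ihg ihk =>
      rw [convolution_add_right hf', convolution_add_left (convolution_mem hf' hg)
        (convolution_mem hf' hk), convolution_add_left hg hk, convolution_add_right hf', ihg, ihk]
    | smul c g hg ih =>
      rw [convolution_smul_right hf', convolution_smul_left (convolution_mem hf' hg),
        convolution_smul_left hg, convolution_smul_right hf', ih]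
  | zero => simp only [convolution_zero_left]
  | add f k hf hk ihf ihk =>
    rw [convolution_add_left hf hk, convolution_add_left (convolution_mem hf hg)
      (convolution_mem hk hg), convolution_add_left hf hk, ihf, ihk]
  | smul c f hf ih =>
    rw [convolution_smul_left hf, convolution_smul_left (convolution_mem hf hg),
      convolution_smul_left hf, ih]

variable (S X) in
/-- The Steinberg algebra `A_S(𝒢)` of the Hausdorff ample groupoid with set of objects `X`. -/
def SteinbergAlgebra : Type max u v w := steinbergSubmodule S X

namespace SteinbergAlgebra

instance : AddCommMonoid (SteinbergAlgebra S X) :=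
  inferInstanceAs (AddCommMonoid (steinbergSubmodule S X))

instance : Module S (SteinbergAlgebra S X) :=
  inferInstanceAs (Module S (steinbergSubmodule S X))

/-- Multiplication is convolution. -/
noncomputable instance : Mul (SteinbergAlgebra S X) :=
  ⟨fun f g => ⟨convolution f.1 g.1, convolution_mem f.2 g.2⟩⟩

noncomputable instance : NonUnitalSemiring (SteinbergAlgebra S X) where
  left_distrib f g h := Subtype.ext (convolution_add_right f.2 g.1 h.1)
  right_distrib f g h := Subtype.ext (convolution_add_left f.2 g.2 h.1)
  zero_mul f := Subtype.ext (convolution_zero_left f.1)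
  mul_zero f := Subtype.ext (convolution_zero_right f.1)
  mul_assoc f g h := Subtype.ext (convolution_assoc f.2 g.2 h.2)

end SteinbergAlgebra

end SteinbergAlgebra

/-! ### Graphs, boundary paths and the graph groupoid -/

section Graph

open Quiver

/-- A vertex is regular if it emits at least one and only finitely many edges. -/
def IsRegularVertex {V : Type u} [Quiver.{v} V] (a : V) : Prop :=
  Nonempty (Star a) ∧ Finite (Star a)

/-- A vertex is singular if it is a sink or an infinite emitter. -/
def IsSingularVertex {V : Type u} [Quiver.{v} V] (a : V) : Prop :=
  IsEmpty (Star a) ∨ Infinite (Star a)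

/-- The boundary paths starting at `a`: the finite paths ending at a sink or an infinite emitter,
and the infinite paths. -/
inductive BoundaryPathFrom {V : Type u} [Quiver.{v} V] (a : V) : Type max u v
  | fin {b : V} (p : Path a b) (hb : IsSingularVertex b) : BoundaryPathFrom a
  | inf (q : ℕ → Total V) (hq : ∀ n, (q n).right = (q (n + 1)).left) (ha : (q 0).left = a) :
      BoundaryPathFrom a

/-- The sequence that begins with a given term and continues with a given sequence. -/
def consSeq {A : Type u} (e : A) (q : ℕ → A) : ℕ → A
  | 0 => e
  | n + 1 => q n

variable {V : Type u} [Quiver.{v} V]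

namespace BoundaryPathFrom

/-- The boundary path `e x` for an edge `e` and a boundary path `x` starting at its range. -/
def cons {a b : V} (e : a ⟶ b) : BoundaryPathFrom b → BoundaryPathFrom a
  | fin p hb => fin (e.toPath.comp p) hb
  | inf q hq ha => inf (consSeq ⟨a, b, e⟩ q) (by rintro (_ | n); exacts [ha.symm, hq n]) rfl

/-- The boundary path `α x` for a finite path `α` and a boundary path `x` starting at
its range. -/
def concat {a : V} : ∀ {b : V}, Path a b → BoundaryPathFrom b → BoundaryPathFrom a
  | _, Path.nil, x => x
  | _, Path.cons p e, x => concat p (cons e x)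

@[simp] theorem concat_nil {a : V} (x : BoundaryPathFrom a) : concat Path.nil x = x := rfl

@[simp] theorem concat_cons {a b c : V} (p : Path a b) (e : b ⟶ c) (x : BoundaryPathFrom c) :
    concat (p.cons e) x = concat p (cons e x) := rfl

theorem concat_comp {a b c : V} (p : Path a b) (q : Path b c) (x : BoundaryPathFrom c) :
    concat (p.comp q) x = concat p (concat q x) := by
  induction q with
  | nil => rfl
  | cons q e ih => rw [Path.comp_cons, concat_cons, ih, concat_cons]

theorem concat_fin {a b c : V} (p : Path a b) (q : Path b c) (h : IsSingularVertex c) :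
    concat p (fin q h) = fin (p.comp q) h := by
  induction p with
  | nil => simp
  | cons p e ih => rw [concat_cons, cons, ih, ← Path.comp_assoc]; rfl

theorem toPath_comp_inj {a b b' c : V} {e : a ⟶ b} {e' : a ⟶ b'} {p : Path b c} {p' : Path b' c}
    (h : e.toPath.comp p = e'.toPath.comp p') :
    (⟨b, e⟩ : Star a) = ⟨b', e'⟩ := by
  have hl := congrArg Path.length h
  simp only [Path.length_comp, Path.length_toPath] at hl
  induction p with
  | nil =>
    cases p' with
    | nil => simp only [Path.comp_nil] at h; rw [show e = e' by simpa [Hom.toPath] using h]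
    | cons p' f => simp at hl
  | cons p f ih =>
    cases p' with
    | nil => simp at hl
    | cons p' f' =>
      rw [Path.comp_cons, Path.comp_cons] at h
      obtain rfl := Path.obj_eq_of_cons_eq_cons h
      exact ih (eq_of_heq (Path.heq_of_cons_eq_cons h)) (by simpa using hl)

theorem cons_edge_inj {a b b' : V} {e : a ⟶ b} {e' : a ⟶ b'} {x : BoundaryPathFrom b}
    {x' : BoundaryPathFrom b'} (h : cons e x = cons e' x') : (⟨b, e⟩ : Star a) = ⟨b', e'⟩ := by
  cases x <;> cases x'
  · rw [cons, cons] at h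
    injection h with h1 h2
    subst h1
    exact toPath_comp_inj (eq_of_heq h2)
  · cases h
  · cases h
  · rw [cons, cons] at h
    injection h with h1
    have := congrFun h1 0
    simp only [consSeq, Total.mk.injEq, true_and] at this
    exact Sigma.ext this.1 this.2

theorem cons_injective {a b : V} (e : a ⟶ b) : Function.Injective (cons e) := by
  intro x x' h
  cases x <;> cases x'
  · rw [cons, cons] at h
    injection h with h1 h2
    subst h1
    rw [Path.comp_injective_right _ (eq_of_heq h2)]
  · cases h
  · cases h
  · rw [cons, cons] at h
    injection h with h1
    congr 1
    funext n
    exact congrFun h1 (n + 1)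

theorem concat_injective {a b : V} (p : Path a b) : Function.Injective (concat p) := by
  induction p with
  | nil => exact fun _ _ h => h
  | cons p e ih => exact fun x y h => cons_injective e (ih h)

theorem prefix_of_concat_eq {a b c : V} (p : Path a b) (q : Path a c) (x : BoundaryPathFrom b)
    (y : BoundaryPathFrom c) (h : concat p x = concat q y) (hl : p.length ≤ q.length) :
    ∃ r : Path b c, q = p.comp r ∧ x = concat r y := by
  induction q generalizing b with
  | nil =>
    cases p with
    | nil => exact ⟨Path.nil, rfl, h⟩
    | cons p e => simp at hl
  | @cons c d q f ih =>
    by_cases hle : p.length ≤ q.length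
    · obtain ⟨r, rfl, rfl⟩ := ih p x (cons f y) h hle
      exact ⟨r.cons f, rfl, rfl⟩
    · cases p with
      | nil => simp at hle
      | cons p e =>
        simp only [Path.length_cons] at hl hle
        obtain ⟨r, rfl, h'⟩ := ih p (cons e x) (cons f y) h (by omega)
        rw [Path.length_comp] at hle
        have hr : r.length = 0 := by omega
        cases r with
        | cons r g => simp at hr
        | nil =>
          have := cons_edge_inj h'
          cases this
          exact ⟨Path.nil, rfl, cons_injective _ h'⟩

theorem eq_fin_nil_or_cons {a : V} (x : BoundaryPathFrom a) :
    (∃ h, x = fin Path.nil h) ∨ ∃ (b : V) (e : a ⟶ b) (y : BoundaryPathFrom b), x = cons e y := by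
  cases x with
  | @fin b p hb =>
    by_cases h0 : p.length = 0
    · cases p with
      | nil => exact Or.inl ⟨hb, rfl⟩
      | cons p e => simp at h0
    · obtain ⟨c, e, p', rfl, -⟩ := p.length_ne_zero_iff_eq_comp.1 h0
      exact Or.inr ⟨c, e, fin p' hb, rfl⟩
  | inf q hq ha =>
    cases ha
    refine Or.inr ⟨_, (q 0).hom, inf (fun n => q (n + 1)) (fun n => hq _) (hq 0).symm, ?_⟩
    rw [cons]
    congr 1
    funext n
    cases n <;> rfl

theorem concat_eq_inf {a b : V} (p : Path a b) (x : BoundaryPathFrom b) {q hq ha}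
    (h : concat p x = inf q hq ha) :
    ∃ q' hq' ha', x = inf q' hq' ha' ∧ ∀ i, q' i = q (p.length + i) := by
  induction p with
  | nil => exact ⟨q, hq, ha, h, fun i => by simp⟩
  | @cons b c p e ih =>
    obtain ⟨q', hq', ha', h', hi⟩ := ih (cons e x) h
    cases x with
    | fin p hb => cases h'
    | inf s hs hc =>
      refine ⟨s, hs, hc, rfl, fun i => ?_⟩
      rw [cons] at h'
      injection h' with h1
      have := hi (i + 1)
      rw [← h1] at this
      rw [Path.length_cons, Nat.add_assoc, Nat.add_comm 1]
      exact this

theorem concat_inf {a b : V} (p : Path a b) (q : ℕ → Total V) (hq hb) :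
    ∃ q' hq' ha', concat p (inf q hq hb) = inf q' hq' ha' := by
  induction p generalizing q with
  | nil => exact ⟨q, hq, hb, rfl⟩
  | cons p e ih => exact ih _ _ _

theorem exists_prefix {a : V} {q : ℕ → Total V} {hq ha} (n : ℕ) :
    ∃ (b : V) (p : Path a b) (x : BoundaryPathFrom b), p.length = n ∧
      concat p x = inf q hq ha := by
  induction n with
  | zero => exact ⟨a, Path.nil, _, rfl, rfl⟩
  | succ n ih =>
    obtain ⟨b, p, x, hn, hx⟩ := ih
    obtain ⟨q', hq', ha', rfl, -⟩ := concat_eq_inf p x hx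
    obtain ⟨_, h⟩ | ⟨c, e, y, h⟩ := eq_fin_nil_or_cons (inf q' hq' ha')
    · cases h
    · exact ⟨c, p.cons e, y, by simp [hn], by rw [concat_cons, ← h, hx]⟩

/-- Two boundary paths with the same finite prefixes are equal. -/
theorem ext_prefix {a : V} (x y : BoundaryPathFrom a)
    (h : ∀ (b : V) (p : Path a b), (∃ w, x = concat p w) ↔ ∃ w, y = concat p w) : x = y := by
  have key : ∀ (x y : BoundaryPathFrom a) (b : V) (p : Path a b) (hb : IsSingularVertex b),
      (∀ (b : V) (p : Path a b), (∃ w, y = concat p w) → ∃ w, x = concat p w) →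
      x = fin p hb → (∃ w, y = concat p w) → x = y := by
    rintro x y b p hb h hx ⟨w, hw⟩
    obtain ⟨_, h'⟩ | ⟨c, e, y', h'⟩ := eq_fin_nil_or_cons w
    · rw [hx, hw, h', concat_fin]; rfl
    · obtain ⟨w', hw'⟩ := h c (p.cons e) ⟨y', by rw [hw, h', concat_cons]⟩
      rw [hx] at hw'
      have : fin p hb = concat p (fin Path.nil hb) := by rw [concat_fin]; rfl
      rw [this, concat_cons] at hw'
      have h2 := concat_injective p hw'
      cases w' with
      | inf => cases h2
      | fin s hs =>
        rw [cons] at h2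
        injection h2 with h3 h4
        subst h3
        have := congrArg Path.length (eq_of_heq h4)
        simp only [Path.length_nil, Path.length_comp, Path.length_toPath] at this
        omega
  cases hx : x with
  | @fin b p hb =>
    rw [← hx]
    refine key x y b p hb (fun c s => (h c s).2) hx ((h b p).1 ⟨fin Path.nil hb, ?_⟩)
    rw [concat_fin, hx]; rfl
  | inf q hq ha =>
    cases hy : y with
    | @fin b p hb =>
      rw [← hx, ← hy]
      refine (key y x b p hb (fun c s => (h c s).1) hy ((h b p).2 ⟨fin Path.nil hb, ?_⟩)).symm
      rw [concat_fin, hy]; rfl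
    | inf s hs hc =>
      congr 1
      funext n
      obtain ⟨b, p, z, hp, hz⟩ := exists_prefix (q := q) (hq := hq) (ha := ha) (n + 1)
      obtain ⟨z', hz'⟩ := (h b p).1 ⟨z, by rw [hx, hz]⟩
      cases p with
      | nil => simp at hp
      | cons p e =>
        rw [hy] at hz'
        rw [concat_cons] at hz hz'
        obtain ⟨q1, _, _, h1, h1'⟩ := concat_eq_inf p _ hz
        obtain ⟨q2, _, _, h2, h2'⟩ := concat_eq_inf p _ hz'.symm
        have e1 := h1' 0
        have e2 := h2' 0
        simp only [Path.length_cons, Nat.add_right_cancel_iff] at hp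
        rw [hp, Nat.add_zero] at e1 e2
        rw [← e1, ← e2]
        cases z with
        | fin => cases h1
        | inf =>
          cases z' with
          | fin => cases h2
          | inf =>
            rw [cons] at h1 h2
            injection h1 with h1
            injection h2 with h2
            rw [← h1, ← h2]
            rfl

end BoundaryPathFrom

variable (V) in
/-- The set of all boundary paths of a graph. -/
structure BoundaryPath where
  start : V
  path : BoundaryPathFrom start

namespace BoundaryPath

/-- The boundary path `α w`. -/
def ofConcat {a b : V} (α : Path a b) (w : BoundaryPathFrom b) : BoundaryPath V :=
  ⟨a, BoundaryPathFrom.concat α w⟩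

theorem ofConcat_comp {a b c : V} (α : Path a b) (δ : Path b c) (w : BoundaryPathFrom c) :
    ofConcat (α.comp δ) w = ofConcat α (BoundaryPathFrom.concat δ w) := by
  rw [ofConcat, ofConcat, BoundaryPathFrom.concat_comp]

theorem ofConcat_injective {a b : V} (α : Path a b) : Function.Injective (ofConcat α) := by
  intro w w' h
  injection h with _ h
  exact BoundaryPathFrom.concat_injective α h

theorem ofConcat_eq {a a' b c : V} {α : Path a b} {β : Path a' c} {w : BoundaryPathFrom b}
    {w' : BoundaryPathFrom c} (h : ofConcat α w = ofConcat β w') (hl : α.length ≤ β.length) :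
    ∃ (h : a = a') (δ : Path b c), β = h ▸ α.comp δ ∧ w = BoundaryPathFrom.concat δ w' := by
  injection h with h1 h2
  subst h1
  exact ⟨rfl, BoundaryPathFrom.prefix_of_concat_eq α β w w' (eq_of_heq h2) hl⟩

/-- The triple `(x, k, y)` lies in the graph groupoid: it is of the form
`(α w, |α| - |β|, β w)` with finite paths `α` and `β` and a boundary path `w` such that
`r(α) = s(w) = r(β)`. -/
def IsArrow (x : BoundaryPath V) (k : ℤ) (y : BoundaryPath V) : Prop :=
  ∃ (a b c : V) (α : Path a c) (β : Path b c) (w : BoundaryPathFrom c),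
    x = ofConcat α w ∧ k = (α.length : ℤ) - β.length ∧ y = ofConcat β w

/-- Two composable arrows can be written with the same middle path. -/
theorem IsArrow.common {x y z : BoundaryPath V} {k l : ℤ} (h : IsArrow x k y)
    (h' : IsArrow y l z) :
    ∃ (a b c d : V) (α : Path a d) (β : Path b d) (γ : Path c d) (w : BoundaryPathFrom d),
      x = ofConcat α w ∧ y = ofConcat β w ∧ z = ofConcat γ w ∧
      k = (α.length : ℤ) - β.length ∧ l = (β.length : ℤ) - γ.length := by
  obtain ⟨a, b, d, α, β, w, rfl, rfl, rfl⟩ := h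
  obtain ⟨b', c, d', β', γ, w', e, rfl, rfl⟩ := h'
  rcases le_total β.length β'.length with hl | hl
  · obtain ⟨rfl, δ, rfl, rfl⟩ := ofConcat_eq e hl
    refine ⟨a, b, c, d', α.comp δ, β.comp δ, γ, w', ?_, ?_, rfl, ?_, rfl⟩
    · rw [ofConcat_comp]
    · rw [ofConcat_comp]
    · simp
  · obtain ⟨rfl, δ, rfl, rfl⟩ := ofConcat_eq e.symm hl
    refine ⟨a, b', c, d, α, β'.comp δ, γ.comp δ, w, rfl, rfl, ?_, rfl, ?_⟩
    · rw [ofConcat_comp]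
    · simp

/-- The graph groupoid, as a groupoid with the boundary paths as objects: the arrows with range
`x` and source `y` are the triples `(x, k, y)`, with `(x, k, y) (y, l, z) = (x, k + l, z)` and
`(x, k, y)⁻¹ = (y, -k, x)`. -/
instance : Groupoid (BoundaryPath V) where
  Hom x y := {k : ℤ // IsArrow x k y}
  id x := ⟨0, x.start, x.start, x.start, Path.nil, Path.nil, x.path, rfl, by simp, rfl⟩
  comp f g := ⟨f.1 + g.1, by
    obtain ⟨a, b, c, d, α, β, γ, w, rfl, rfl, rfl, h1, h2⟩ := f.2.common g.2
    exact ⟨a, c, d, α, γ, w, rfl, by omega, rfl⟩⟩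
  id_comp _ := Subtype.ext (zero_add _)
  comp_id _ := Subtype.ext (add_zero _)
  assoc _ _ _ := Subtype.ext (add_assoc _ _ _)
  inv f := ⟨-f.1, by
    obtain ⟨a, b, c, α, β, w, h1, h2, h3⟩ := f.2
    exact ⟨b, a, c, β, α, w, h3, by omega, h1⟩⟩
  inv_comp _ := Subtype.ext (neg_add_cancel _)
  comp_inv _ := Subtype.ext (add_neg_cancel _)

/-- The integer `k` of an arrow `(x, k, y)`. -/
def degree (γ : Arr (BoundaryPath V)) : ℤ := γ.hom.1

theorem arr_ext {γ γ' : Arr (BoundaryPath V)} (h : γ.rngObj = γ'.rngObj)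
    (h' : degree γ = degree γ') (h'' : γ.srcObj = γ'.srcObj) : γ = γ' := by
  obtain ⟨x, y, k⟩ := γ
  obtain ⟨x', y', k'⟩ := γ'
  obtain rfl : x = x' := h
  obtain rfl : y = y' := h''
  obtain rfl : k = k' := Subtype.ext h'
  rfl

theorem degree_comp {γ γ' : Arr (BoundaryPath V)} (h : γ.srcObj = γ'.rngObj) :
    degree (γ.comp γ' h) = degree γ + degree γ' := by
  obtain ⟨x, y, k⟩ := γ
  obtain ⟨y', z, k'⟩ := γ'
  obtain rfl : y = y' := h
  simp only [Arr.comp, eqToHom_refl, Category.id_comp]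
  rfl

theorem degree_inv (γ : Arr (BoundaryPath V)) : degree γ.inv = -degree γ := rfl

theorem degree_one (x : BoundaryPath V) : degree (Arr.one x) = 0 := rfl

/-- The set `Z(α, β)` of all `(α w, |α| - |β|, β w)`. -/
def cylinder {a b c : V} (α : Path a c) (β : Path b c) : Set (Arr (BoundaryPath V)) :=
  {γ | ∃ w : BoundaryPathFrom c, γ.rngObj = ofConcat α w ∧
    degree γ = (α.length : ℤ) - β.length ∧ γ.srcObj = ofConcat β w}

/-- The set `Z(α, β, F)`, that is `Z(α, β)` without all `Z(αe, βe)`, `e ∈ F`, for a finite set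
`F` of edges starting at `r(α) = r(β)`. -/
def cylinderDiff {a b c : V} (α : Path a c) (β : Path b c) (F : Finset (Star c)) :
    Set (Arr (BoundaryPath V)) :=
  cylinder α β \ ⋃ e ∈ F, cylinder (α.cons e.2) (β.cons e.2)

/-- The topology of the graph groupoid, generated by the sets `Z(α, β, F)`
(which form a base of it). -/
instance : TopologicalSpace (Arr (BoundaryPath V)) :=
  .generateFrom {U | ∃ (a b c : V) (α : Path a c) (β : Path b c) (F : Finset (Star c)),
    U = cylinderDiff α β F}

theorem mem_cylinderDiff {a b c : V} {α : Path a c} {β : Path b c} {F : Finset (Star c)}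
    {γ : Arr (BoundaryPath V)} :
    γ ∈ cylinderDiff α β F ↔ ∃ w : BoundaryPathFrom c, γ.rngObj = ofConcat α w ∧
      degree γ = (α.length : ℤ) - β.length ∧ γ.srcObj = ofConcat β w ∧
      ∀ e ∈ F, ∀ w', w ≠ BoundaryPathFrom.cons e.2 w' := by
  constructor
  · rintro ⟨⟨w, h1, h2, h3⟩, h⟩
    refine ⟨w, h1, h2, h3, fun e he w' hw => h ?_⟩
    subst hw
    exact Set.mem_biUnion he ⟨w', h1, by simp [h2], h3⟩
  · rintro ⟨w, h1, h2, h3, h⟩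
    refine ⟨⟨w, h1, h2, h3⟩, fun h' => ?_⟩
    simp only [Set.mem_iUnion] at h'
    obtain ⟨e, he, w', h1', -, -⟩ := h'
    exact h e he w' (ofConcat_injective α (h1.symm.trans h1'))

theorem cylinderDiff_empty {a b c : V} (α : Path a c) (β : Path b c) :
    cylinderDiff α β ∅ = cylinder α β := by simp [cylinderDiff]

theorem isOpen_cylinderDiff {a b c : V} (α : Path a c) (β : Path b c) (F : Finset (Star c)) :
    IsOpen (cylinderDiff α β F) :=
  TopologicalSpace.isOpen_generateFrom_of_mem ⟨a, b, c, α, β, F, rfl⟩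

theorem isOpen_cylinder {a b c : V} (α : Path a c) (β : Path b c) :
    IsOpen (cylinder α β) := by
  rw [← cylinderDiff_empty]; exact isOpen_cylinderDiff α β ∅

theorem cylinder_comp_subset {a b c d : V} (α : Path a c) (β : Path b c) (δ : Path c d) :
    cylinder (α.comp δ) (β.comp δ) ⊆ cylinder α β := by
  rintro γ ⟨w, h1, h2, h3⟩
  refine ⟨BoundaryPathFrom.concat δ w, ?_, ?_, ?_⟩
  · rw [h1, ofConcat_comp]
  · simp [h2]
  · rw [h3, ofConcat_comp]

theorem exists_mem_cylinder (γ : Arr (BoundaryPath V)) :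
    ∃ (a b c : V) (α : Path a c) (β : Path b c), γ ∈ cylinder α β := by
  obtain ⟨x, y, k, a, b, c, α, β, w, h1, h2, h3⟩ := γ
  exact ⟨a, b, c, α, β, w, h1, h2, h3⟩

/-- If an element of `Z(α, β, F)` lies in `Z(αδ, βδ)` and `δ` has positive length, then
`Z(αδ, βδ)` is contained in `Z(α, β, F)`. -/
theorem cylinder_subset_cylinderDiff {a b c d : V} {α : Path a c} {β : Path b c} {δ : Path c d}
    {F : Finset (Star c)} {γ : Arr (BoundaryPath V)} (hγ : γ ∈ cylinder (α.comp δ) (β.comp δ))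
    (hγ' : γ ∈ cylinderDiff α β F) (hδ : δ.length ≠ 0) :
    cylinder (α.comp δ) (β.comp δ) ⊆ cylinderDiff α β F := by
  obtain ⟨t, e, δ, rfl, -⟩ := δ.length_ne_zero_iff_eq_comp.1 hδ
  obtain ⟨w, h1, h2, h3⟩ := hγ
  obtain ⟨u, h1', h2', h3', hF⟩ := mem_cylinderDiff.1 hγ'
  have hu : u = BoundaryPathFrom.cons e (BoundaryPathFrom.concat δ w) := by
    apply ofConcat_injective α
    rw [← h1', h1, ofConcat_comp, BoundaryPathFrom.concat_comp]; rfl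
  have he : (⟨t, e⟩ : Star c) ∉ F := fun he => hF _ he _ hu
  rintro γ' hγ'
  obtain ⟨v, k1, k2, k3⟩ := hγ'
  refine mem_cylinderDiff.2 ⟨BoundaryPathFrom.cons e (BoundaryPathFrom.concat δ v), ?_, ?_, ?_, ?_⟩
  · rw [k1, ofConcat_comp, BoundaryPathFrom.concat_comp]; rfl
  · simp [k2]
  · rw [k3, ofConcat_comp, BoundaryPathFrom.concat_comp]; rfl
  · rintro f hf w' hw
    have := BoundaryPathFrom.cons_edge_inj hw
    exact he (this ▸ hf)

theorem exists_cylinderDiff_subset_inter {a b c d : V} {α : Path a c} {β : Path b c} {δ : Path c d}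
    {F : Finset (Star c)} {G : Finset (Star d)} {γ : Arr (BoundaryPath V)}
    (hγ : γ ∈ cylinderDiff (α.comp δ) (β.comp δ) G) (hγ' : γ ∈ cylinderDiff α β F) :
    ∃ G' : Finset (Star d), γ ∈ cylinderDiff (α.comp δ) (β.comp δ) G' ∧
      cylinderDiff (α.comp δ) (β.comp δ) G' ⊆
        cylinderDiff (α.comp δ) (β.comp δ) G ∩ cylinderDiff α β F := by
  classical
  by_cases hδ : δ.length = 0
  · cases δ with
    | cons δ e => simp at hδ
    | nil =>
      refine ⟨G ∪ F, ⟨hγ.1, ?_⟩, fun γ' hγ' => ⟨⟨hγ'.1, ?_⟩, hγ'.1, ?_⟩⟩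
      · rw [Finset.set_biUnion_union]
        exact fun h => h.elim hγ.2 hγ'.2
      · exact fun h => hγ'.2 (by rw [Finset.set_biUnion_union]; exact Or.inl h)
      · exact fun h => hγ'.2 (by rw [Finset.set_biUnion_union]; exact Or.inr h)
  · exact ⟨G, hγ, fun γ' h => ⟨h, cylinder_subset_cylinderDiff hγ.1 hγ' hδ h.1⟩⟩

/-- The neighbourhoods of an element of `Z(α, β)`. -/
theorem exists_cylinderDiff_subset {W : Set (Arr (BoundaryPath V))} (hW : IsOpen W)
    {γ : Arr (BoundaryPath V)} (hγW : γ ∈ W) {a b c : V} {α : Path a c} {β : Path b c}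
    (hγ : γ ∈ cylinder α β) :
    ∃ (d : V) (δ : Path c d) (F : Finset (Star d)),
      γ ∈ cylinderDiff (α.comp δ) (β.comp δ) F ∧ cylinderDiff (α.comp δ) (β.comp δ) F ⊆ W := by
  induction hW generalizing c with
  | univ =>
    exact ⟨c, Path.nil, ∅, by rw [cylinderDiff_empty]; exact hγ, Set.subset_univ _⟩
  | sUnion 𝒮 _ ih =>
    obtain ⟨T, hT, hγT⟩ := hγW
    obtain ⟨d, δ, F, h1, h2⟩ := ih T hT hγT hγ
    exact ⟨d, δ, F, h1, h2.trans (Set.subset_sUnion_of_mem hT)⟩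
  | inter W₁ W₂ _ _ ih₁ ih₂ =>
    obtain ⟨d, δ, F, h1, h2⟩ := ih₁ hγW.1 hγ
    obtain ⟨d', δ', F', h1', h2'⟩ := ih₂ hγW.2 h1.1
    obtain ⟨G, hG, hG'⟩ := exists_cylinderDiff_subset_inter h1' h1
    refine ⟨d', δ.comp δ', G, ?_, ?_⟩
    · rwa [← Path.comp_assoc, ← Path.comp_assoc]
    · rw [← Path.comp_assoc, ← Path.comp_assoc]
      exact fun γ h => ⟨h2 (hG' h).2, h2' (hG' h).1⟩
  | basic W hW =>
    obtain ⟨a', b', c', α', β', F, rfl⟩ := hW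
    obtain ⟨w, h1, h2, h3⟩ := hγ
    obtain ⟨w', h1', h2', h3'⟩ := hγW.1
    rcases le_total α.length α'.length with hl | hl
    · obtain ⟨rfl, δ, rfl, hw⟩ := ofConcat_eq (h1.symm.trans h1') hl
      simp only [Path.length_comp, Nat.cast_add] at h2'
      obtain ⟨rfl, δ', rfl, hw'⟩ := ofConcat_eq (h3.symm.trans h3') (by omega)
      simp only [Path.length_comp, Nat.cast_add] at h2'
      obtain ⟨ε, rfl, hε⟩ := BoundaryPathFrom.prefix_of_concat_eq δ δ' w' w' (hw.symm.trans hw')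
        (by omega)
      simp only [Path.length_comp, Nat.cast_add] at h2'
      cases ε with
      | cons ε e => simp only [Path.length_cons] at h2'; omega
      | nil => exact ⟨c', δ, F, hγW, subset_rfl⟩
    · obtain ⟨rfl, δ, rfl, hw⟩ := ofConcat_eq (h1'.symm.trans h1) hl
      simp only [Path.length_comp, Nat.cast_add] at h2
      obtain ⟨rfl, δ', rfl, hw'⟩ := ofConcat_eq (h3'.symm.trans h3) (by omega)
      simp only [Path.length_comp, Nat.cast_add] at h2
      obtain ⟨ε, rfl, hε⟩ := BoundaryPathFrom.prefix_of_concat_eq δ δ' w w (hw.symm.trans hw')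
        (by omega)
      simp only [Path.length_comp, Nat.cast_add] at h2
      cases ε with
      | cons ε e => simp only [Path.length_cons] at h2; omega
      | nil =>
        have hγ : γ ∈ cylinderDiff (α'.comp δ) (β'.comp δ) ∅ := by
          rw [cylinderDiff_empty]
          exact ⟨w, h1, by simp [h2], h3⟩
        obtain ⟨G, hG, hG'⟩ := exists_cylinderDiff_subset_inter hγ hγW
        exact ⟨c, Path.nil, G, hG, fun γ h => (hG' h).2⟩

theorem mem_cylinder_nil (x : BoundaryPath V) :
    Arr.one x ∈ cylinder (Path.nil : Path x.start x.start) Path.nil :=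
  ⟨x.path, rfl, rfl, rfl⟩

theorem one_mem_cylinder {a c : V} (α : Path a c) (w : BoundaryPathFrom c) :
    Arr.one (ofConcat α w) ∈ cylinder α α := ⟨w, rfl, by simp [degree_one], rfl⟩

theorem continuous_inv :
    Continuous (Arr.inv : Arr (BoundaryPath V) → Arr (BoundaryPath V)) := by
  refine continuous_generateFrom_iff.2 ?_
  rintro _ ⟨a, b, c, α, β, F, rfl⟩
  convert isOpen_cylinderDiff β α F using 1
  ext γ
  rw [Set.mem_preimage, mem_cylinderDiff, mem_cylinderDiff]
  constructor
  · rintro ⟨w, h1, h2, h3, h4⟩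
    rw [degree_inv] at h2
    exact ⟨w, h3, by omega, h1, h4⟩
  · rintro ⟨w, h1, h2, h3, h4⟩
    exact ⟨w, h3, by rw [degree_inv]; omega, h1, h4⟩

theorem continuous_comp :
    Continuous fun p : Arr.composable (BoundaryPath V) => p.1.1.comp p.1.2 p.2 := by
  refine continuous_def.2 fun W hW => isOpen_iff_mem_nhds.2 ?_
  rintro ⟨⟨⟨x, y, k⟩, ⟨y', z, l⟩⟩, hxy⟩ hp
  obtain rfl : y = y' := hxy
  obtain ⟨a, b, c, d, α, β, γ, w, rfl, rfl, rfl, h1, h2⟩ := k.2.common l.2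
  have hc : Arr.comp ⟨ofConcat α w, ofConcat β w, k⟩ ⟨ofConcat β w, ofConcat γ w, l⟩ rfl
      ∈ cylinder α γ := by
    refine ⟨w, rfl, ?_, rfl⟩
    rw [degree_comp]
    simp only [degree]
    omega
  obtain ⟨t, δ, F, hm, hs⟩ := exists_cylinderDiff_subset hW hp hc
  obtain ⟨u, e1, -, -, hF⟩ := mem_cylinderDiff.1 hm
  obtain rfl : w = BoundaryPathFrom.concat δ u := by
    apply ofConcat_injective α
    rw [← ofConcat_comp, ← e1]; rfl
  have ho : IsOpen ((Subtype.val : Arr.composable (BoundaryPath V) → _) ⁻¹'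
      (cylinderDiff (α.comp δ) (β.comp δ) F ×ˢ cylinder (β.comp δ) (γ.comp δ))) :=
    ((isOpen_cylinderDiff _ _ _).prod (isOpen_cylinder _ _)).preimage continuous_subtype_val
  refine Filter.mem_of_superset (ho.mem_nhds ⟨mem_cylinderDiff.2
    ⟨u, (ofConcat_comp _ _ _).symm, ?_, (ofConcat_comp _ _ _).symm, hF⟩,
      u, (ofConcat_comp _ _ _).symm, ?_, (ofConcat_comp _ _ _).symm⟩) ?_
  · simp only [degree, Path.length_comp]; omega
  · simp only [degree, Path.length_comp]; omega
  · rintro ⟨⟨γ₁, γ₂⟩, hg⟩ ⟨hm1, v', k1, k2, k3⟩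
    obtain ⟨v, g1, g2, g3, g4⟩ := mem_cylinderDiff.1 hm1
    obtain rfl : v = v' := ofConcat_injective _ (g3.symm.trans (Eq.trans hg k1))
    refine hs (mem_cylinderDiff.2 ⟨v, g1, ?_, k3, g4⟩)
    dsimp only at g2 k2
    have := degree_comp (γ := γ₁) (γ' := γ₂) hg
    change degree (γ₁.comp γ₂ hg) = _
    omega

theorem continuous_one_source :
    Continuous fun γ : Arr (BoundaryPath V) => Arr.one γ.srcObj := by
  have h : Continuous fun γ : Arr (BoundaryPath V) =>
      (⟨(γ.inv, γ), rfl⟩ : Arr.composable (BoundaryPath V)) :=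
    (continuous_inv.prodMk continuous_id).subtype_mk _
  refine (continuous_comp.comp h).congr fun γ => ?_
  refine arr_ext rfl ?_ rfl
  have := degree_comp (γ := γ.inv) (γ' := γ) rfl
  rw [degree_inv, neg_add_cancel] at this
  exact this

theorem continuous_one_range :
    Continuous fun γ : Arr (BoundaryPath V) => Arr.one γ.rngObj :=
  continuous_one_source.comp continuous_inv

theorem exists_open_disjoint {a c : V} (α : Path a c) (y : BoundaryPath V)
    (hy : ¬ ∃ w, y = ofConcat α w) :
    ∃ W, IsOpen W ∧ Arr.one y ∈ W ∧ Disjoint W (cylinder α α) := by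
  by_cases ha : y.start = a
  · obtain ⟨_, y⟩ := y
    dsimp only at ha
    subst ha
    induction α with
    | nil => exact absurd ⟨y, rfl⟩ hy
    | @cons b c p e ih =>
      by_cases hp : ∃ w, (⟨_, y⟩ : BoundaryPath V) = ofConcat p w
      · obtain ⟨w, hw⟩ := hp
        refine ⟨cylinderDiff p p {⟨c, e⟩}, isOpen_cylinderDiff _ _ _, ?_, ?_⟩
        · refine mem_cylinderDiff.2 ⟨w, hw, by simp [degree_one], hw, ?_⟩
          intro f hf w' hw'
          rw [Finset.mem_singleton] at hf
          subst hf
          subst hw'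
          exact hy ⟨w', hw⟩
        · refine Set.disjoint_left.2 fun γ h1 h2 => h1.2 ?_
          simpa using h2
      · obtain ⟨W, h1, h2, h3⟩ := ih hp
        exact ⟨W, h1, h2, h3.mono_right (cylinder_comp_subset p p e.toPath)⟩
  · refine ⟨_, isOpen_cylinder _ _, mem_cylinder_nil y, Set.disjoint_left.2 ?_⟩
    rintro γ ⟨w, h1, -, -⟩ ⟨w', h1', -, -⟩
    exact ha (congrArg start (h1.symm.trans h1'))

theorem separate_one {x y : BoundaryPath V} (h : x ≠ y) :
    ∃ U W, IsOpen U ∧ IsOpen W ∧ Arr.one x ∈ U ∧ Arr.one y ∈ W ∧ Disjoint U W := by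
  have : ∃ (a c : V) (α : Path a c), ¬ ((∃ w, x = ofConcat α w) ↔ ∃ w, y = ofConcat α w) := by
    by_contra! hc
    obtain ⟨a, x⟩ := x
    obtain ⟨b, y⟩ := y
    obtain ⟨w, hw⟩ := (hc a a Path.nil).1 ⟨x, rfl⟩
    obtain rfl : b = a := congrArg start hw
    refine h (congrArg _ (BoundaryPathFrom.ext_prefix x y fun c p => ?_))
    simpa [ofConcat] using hc b c p
  obtain ⟨a, c, α, hα⟩ := this
  by_cases hx : ∃ w, x = ofConcat α w
  · have hy : ¬ ∃ w, y = ofConcat α w := fun hy => hα (iff_of_true hx hy)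
    obtain ⟨W, h1, h2, h3⟩ := exists_open_disjoint α y hy
    obtain ⟨w, rfl⟩ := hx
    exact ⟨_, W, isOpen_cylinder α α, h1, one_mem_cylinder α w, h2, h3.symm⟩
  · have hy : ∃ w, y = ofConcat α w := by
      by_contra hy
      exact hα (iff_of_false hx hy)
    obtain ⟨W, h1, h2, h3⟩ := exists_open_disjoint α x hx
    obtain ⟨w, rfl⟩ := hy
    exact ⟨W, _, h1, isOpen_cylinder α α, h2, one_mem_cylinder α w, h3⟩

instance : T2Space (Arr (BoundaryPath V)) := by
  refine ⟨fun γ γ' hne => ?_⟩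
  by_cases hr : γ.rngObj = γ'.rngObj
  · by_cases hs : γ.srcObj = γ'.srcObj
    · obtain ⟨a, b, c, α, β, hγ⟩ := exists_mem_cylinder γ
      obtain ⟨a', b', c', α', β', hγ'⟩ := exists_mem_cylinder γ'
      refine ⟨_, _, isOpen_cylinder α β, isOpen_cylinder α' β', hγ, hγ', Set.disjoint_left.2 ?_⟩
      rintro δ ⟨-, -, h, -⟩ ⟨-, -, h', -⟩
      obtain ⟨-, -, k, -⟩ := hγ
      obtain ⟨-, -, k', -⟩ := hγ'
      exact hne (arr_ext hr (by rw [k, k', ← h, ← h']) hs)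
    · obtain ⟨U, W, h1, h2, h3, h4, h5⟩ := separate_one hs
      exact ⟨_, _, h1.preimage continuous_one_source, h2.preimage continuous_one_source, h3, h4,
        h5.preimage _⟩
  · obtain ⟨U, W, h1, h2, h3, h4, h5⟩ := separate_one hr
    exact ⟨_, _, h1.preimage continuous_one_range, h2.preimage continuous_one_range, h3, h4,
      h5.preimage _⟩

theorem continuous_source :
    Continuous (Arr.source : Arr (BoundaryPath V) → Arr.unitSpace (BoundaryPath V)) :=
  continuous_one_source.subtype_mk _

theorem injOn_source_cylinder {a b c : V} (α : Path a c) (β : Path b c) :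
    Set.InjOn Arr.source (cylinder α β) := by
  rintro γ ⟨w, h1, h2, h3⟩ γ' ⟨w', h1', h2', h3'⟩ h
  rw [Arr.source_eq_iff] at h
  obtain rfl : w = w' := ofConcat_injective _ (h3.symm.trans (h.trans h3'))
  exact arr_ext (h1.trans h1'.symm) (h2.trans h2'.symm) h

theorem isOpen_image_source {a b c : V} {α : Path a c} {β : Path b c}
    {W : Set (Arr (BoundaryPath V))} (hW : IsOpen W) (hWs : W ⊆ cylinder α β) :
    IsOpen (Arr.source '' W) := by
  rw [isOpen_iff_mem_nhds]
  rintro _ ⟨γ, hγ, rfl⟩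
  obtain ⟨d, δ, F, h1, h2⟩ := exists_cylinderDiff_subset hW hγ (hWs hγ)
  have ho : IsOpen ((Subtype.val : Arr.unitSpace (BoundaryPath V) → _) ⁻¹'
      cylinderDiff (β.comp δ) (β.comp δ) F) :=
    (isOpen_cylinderDiff _ _ _).preimage continuous_subtype_val
  refine Filter.mem_of_superset (ho.mem_nhds ?_) ?_
  · obtain ⟨w, -, -, k3, k4⟩ := mem_cylinderDiff.1 h1
    exact mem_cylinderDiff.2 ⟨w, k3, by simp [Arr.source, degree_one], k3, k4⟩
  · rintro ⟨_, x, rfl⟩ hx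
    obtain ⟨w, k1, -, k3, k4⟩ := mem_cylinderDiff.1 hx
    refine ⟨⟨ofConcat (α.comp δ) w, x, ((α.comp δ).length : ℤ) - (β.comp δ).length,
      _, _, _, α.comp δ, β.comp δ, w, rfl, rfl, k3⟩,
      h2 (mem_cylinderDiff.2 ⟨w, rfl, rfl, k3, k4⟩), rfl⟩

theorem isOpenEmbedding_source {U : Set (Arr (BoundaryPath V))} (hU : IsOpen U) {a b c : V}
    {α : Path a c} {β : Path b c} (hUs : U ⊆ cylinder α β) :
    IsOpenEmbedding (U.domRestrict Arr.source) := by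
  refine .of_continuous_injective_isOpenMap (continuous_source.comp continuous_subtype_val)
    ((injOn_source_cylinder α β).mono hUs).injective fun W hW => ?_
  have : U.domRestrict Arr.source '' W = Arr.source '' (Subtype.val '' W) := by
    rw [Set.image_image]; rfl
  rw [this]
  refine isOpen_image_source (α := α) (β := β) (hU.isOpenMap_subtype_val _ hW) ?_
  rintro _ ⟨γ, -, rfl⟩
  exact hUs γ.2

theorem isOpenBisection_cylinderDiff {a b c : V} (α : Path a c) (β : Path b c)
    (F : Finset (Star c)) : Arr.IsOpenBisection (cylinderDiff α β F) := by
  refine ⟨isOpen_cylinderDiff α β F,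
    isOpenEmbedding_source (isOpen_cylinderDiff α β F) Set.sdiff_subset, ?_⟩
  have h := isOpenEmbedding_source (isOpen_cylinderDiff β α F) Set.sdiff_subset
  have hmap : ∀ {a b c : V} (α : Path a c) (β : Path b c) (F : Finset (Star c))
      (γ : Arr (BoundaryPath V)), γ ∈ cylinderDiff α β F → γ.inv ∈ cylinderDiff β α F := by
    intro a b c α β F γ hγ
    obtain ⟨w, h1, h2, h3, h4⟩ := mem_cylinderDiff.1 hγ
    exact mem_cylinderDiff.2 ⟨w, h3, by rw [degree_inv]; omega, h1, h4⟩
  let e : cylinderDiff α β F ≃ₜ cylinderDiff β α F :=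
    { toFun := fun γ => ⟨γ.1.inv, hmap _ _ _ _ γ.2⟩
      invFun := fun γ => ⟨γ.1.inv, hmap _ _ _ _ γ.2⟩
      left_inv := fun γ => Subtype.ext (Arr.inv_inv _)
      right_inv := fun γ => Subtype.ext (Arr.inv_inv _)
      continuous_toFun := (continuous_inv.comp continuous_subtype_val).subtype_mk _
      continuous_invFun := (continuous_inv.comp continuous_subtype_val).subtype_mk _ }
  exact h.comp e.isOpenEmbedding

theorem le_nhds_of {𝒰 : Ultrafilter (Arr (BoundaryPath V))} {a b c : V} {α : Path a c}
    {β : Path b c} {γ : Arr (BoundaryPath V)} (hγ : γ ∈ cylinder α β)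
    (h : ∀ (d : V) (ε : Path c d) (G : Finset (Star d)),
      γ ∈ cylinderDiff (α.comp ε) (β.comp ε) G → cylinderDiff (α.comp ε) (β.comp ε) G ∈ 𝒰) :
    (𝒰 : Filter (Arr (BoundaryPath V))) ≤ 𝓝 γ := by
  intro W hW
  obtain ⟨W', hW', ho, hm⟩ := mem_nhds_iff.1 hW
  obtain ⟨d, δ, F, h1, h2⟩ := exists_cylinderDiff_subset ho hm hγ
  exact Filter.mem_of_superset (h d δ F h1) (h2.trans hW')

/-- The element `(α w, |α| - |β|, β w)` of `Z(α, β)`. -/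
def mkArr {a b c : V} (α : Path a c) (β : Path b c) (w : BoundaryPathFrom c) :
    Arr (BoundaryPath V) :=
  ⟨ofConcat α w, ofConcat β w, (α.length : ℤ) - β.length, a, b, c, α, β, w, rfl, rfl, rfl⟩

theorem mkArr_mem {a b c : V} (α : Path a c) (β : Path b c) (w : BoundaryPathFrom c) :
    mkArr α β w ∈ cylinder α β := ⟨w, rfl, rfl, rfl⟩

theorem mkArr_concat {a b c d : V} (α : Path a c) (β : Path b c) (δ : Path c d)
    (w : BoundaryPathFrom d) :
    mkArr α β (BoundaryPathFrom.concat δ w) = mkArr (α.comp δ) (β.comp δ) w := by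
  refine arr_ext (ofConcat_comp _ _ _).symm ?_ (ofConcat_comp _ _ _).symm
  change (α.length : ℤ) - β.length = ((α.comp δ).length : ℤ) - (β.comp δ).length
  simp

/-- Every ultrafilter on `Z(α, β)` converges. -/
theorem exists_le_nhds {𝒰 : Ultrafilter (Arr (BoundaryPath V))} {a b c : V} {α : Path a c}
    {β : Path b c} (h𝒰 : cylinder α β ∈ 𝒰) :
    ∃ γ ∈ cylinder α β, ∀ (d : V) (ε : Path c d) (G : Finset (Star d)),
      γ ∈ cylinderDiff (α.comp ε) (β.comp ε) G → cylinderDiff (α.comp ε) (β.comp ε) G ∈ 𝒰 := by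
  classical
  by_cases hmax : ∃ (d : V) (δ : Path c d), cylinder (α.comp δ) (β.comp δ) ∈ 𝒰 ∧
      ∀ e : Star d, cylinder ((α.comp δ).cons e.2) ((β.comp δ).cons e.2) ∉ 𝒰
  · obtain ⟨d, δ, hδ, he⟩ := hmax
    have hd : IsSingularVertex d := by
      by_contra hd
      rw [IsSingularVertex, not_or, not_infinite_iff_finite] at hd
      have hfin := hd.2
      have hsub : cylinder (α.comp δ) (β.comp δ) ⊆ ⋃ e ∈ (Set.univ : Set (Star d)),
          cylinder ((α.comp δ).cons e.2) ((β.comp δ).cons e.2) := by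
        rintro γ ⟨w, h1, h2, h3⟩
        obtain ⟨h, -⟩ | ⟨t, e, y, rfl⟩ := w.eq_fin_nil_or_cons
        · rcases h with h | h
          · exact absurd h hd.1
          · exact absurd hfin h.not_finite
        · exact Set.mem_biUnion (Set.mem_univ (⟨t, e⟩ : Star d)) ⟨y, h1, by simp [h2], h3⟩
      obtain ⟨e, -, h⟩ := (Ultrafilter.finite_biUnion_mem_iff Set.finite_univ).1
        (Filter.mem_of_superset hδ hsub)
      exact he e h
    refine ⟨mkArr α β (.concat δ (.fin Path.nil hd)), mkArr_mem _ _ _, fun t ε G hG => ?_⟩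
    obtain ⟨w, h1, -, -, -⟩ := mem_cylinderDiff.1 hG
    have hw : BoundaryPathFrom.concat δ (.fin Path.nil hd) = .concat ε w := by
      apply ofConcat_injective α
      rw [← ofConcat_comp α ε, ← h1]; rfl
    have hr : ∃ r : Path t d, δ = ε.comp r := by
      rcases le_total ε.length δ.length with hl | hl
      · obtain ⟨r, hr, -⟩ := BoundaryPathFrom.prefix_of_concat_eq _ _ _ _ hw.symm hl
        exact ⟨r, hr⟩
      · obtain ⟨r, rfl, h'⟩ := BoundaryPathFrom.prefix_of_concat_eq _ _ _ _ hw hl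
        cases w with
        | @fin s p hb =>
          rw [BoundaryPathFrom.concat_fin] at h'
          injection h' with e1 e2
          subst e1
          have := congrArg Path.length (eq_of_heq e2)
          rw [Path.length_nil, Path.length_comp] at this
          cases r with
          | nil => exact ⟨Path.nil, rfl⟩
          | cons r f => rw [Path.length_cons] at this; omega
        | inf q hq ha =>
          obtain ⟨_, _, _, h''⟩ := BoundaryPathFrom.concat_inf r q hq ha
          rw [h''] at h'
          cases h'
    obtain ⟨r, rfl⟩ := hr
    rw [mkArr_concat] at hG
    by_cases h0 : r.length = 0
    · cases r with
      | cons r f => simp at h0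
      | nil =>
        refine Filter.inter_mem hδ (Ultrafilter.compl_mem_iff_notMem.2 fun h => ?_)
        obtain ⟨e, -, h⟩ := (Ultrafilter.finite_biUnion_mem_iff G.finite_toSet).1 h
        exact he e h
    · refine Filter.mem_of_superset hδ ?_
      have hm := mkArr_mem (α.comp (ε.comp r)) (β.comp (ε.comp r))
        (BoundaryPathFrom.fin Path.nil hd)
      rw [← Path.comp_assoc, ← Path.comp_assoc] at hm hG ⊢
      exact cylinder_subset_cylinderDiff hm hG h0
  · push Not at hmax
    choose e he using hmax
    let st := Σ d : V, {δ : Path c d // cylinder (α.comp δ) (β.comp δ) ∈ 𝒰}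
    let next : st → st := fun s =>
      ⟨(e s.1 s.2.1 s.2.2).1, s.2.1.cons (e s.1 s.2.1 s.2.2).2, he s.1 s.2.1 s.2.2⟩
    let s : ℕ → st := fun n => Nat.rec ⟨c, Path.nil, h𝒰⟩ (fun _ => next) n
    let q : ℕ → Total V := fun n =>
      ⟨(s n).1, (s (n + 1)).1, (e (s n).1 (s n).2.1 (s n).2.2).2⟩
    have hlen : ∀ n, (s n).2.1.length = n := by
      intro n
      induction n with
      | zero => rfl
      | succ n ih => exact congrArg Nat.succ ih
    have hpre : ∀ n, BoundaryPathFrom.inf q (fun _ => rfl) (rfl : _ = c) =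
        .concat (s n).2.1 (.inf (fun i => q (n + i)) (fun _ => rfl) rfl) := by
      intro n
      induction n with
      | zero =>
        change _ = BoundaryPathFrom.inf _ _ _
        congr 1
        funext i
        rw [Nat.zero_add]
      | succ n ih =>
        refine ih.trans ?_
        change _ = BoundaryPathFrom.concat (s n).2.1 (.cons _ _)
        congr 1
        rw [BoundaryPathFrom.cons]
        congr 1
        funext i
        cases i with
        | zero => rfl
        | succ i =>
          exact congrArg q (by omega : n + (i + 1) = n + 1 + i)
    refine ⟨mkArr α β (.inf q (fun _ => rfl) rfl), mkArr_mem _ _ _, fun t ε G hG => ?_⟩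
    obtain ⟨w, h1, -, -, -⟩ := mem_cylinderDiff.1 hG
    have hw : BoundaryPathFrom.inf q (fun _ => rfl) (rfl : _ = c) = .concat ε w := by
      apply ofConcat_injective α
      rw [← ofConcat_comp α ε, ← h1]; rfl
    have hn := hlen (ε.length + 1)
    have hpn := hpre (ε.length + 1)
    have hU := (s (ε.length + 1)).2.2
    obtain ⟨r, hr, -⟩ := BoundaryPathFrom.prefix_of_concat_eq _ _ _ _
      (hw.symm.trans hpn) (by omega)
    have h0 : r.length ≠ 0 := by
      rw [hr, Path.length_comp] at hn
      omega
    rw [hpn, mkArr_concat] at hG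
    refine Filter.mem_of_superset hU ?_
    have hm := mkArr_mem (α.comp (s (ε.length + 1)).2.1) (β.comp (s (ε.length + 1)).2.1)
      (.inf (fun i => q (ε.length + 1 + i)) (fun _ => rfl) rfl)
    generalize mkArr (α.comp (s (ε.length + 1)).2.1) (β.comp (s (ε.length + 1)).2.1)
      (.inf (fun i => q (ε.length + 1 + i)) (fun _ => rfl) rfl) = γ at hm hG
    rw [hr, ← Path.comp_assoc, ← Path.comp_assoc] at hm ⊢
    exact cylinder_subset_cylinderDiff hm hG h0

theorem isCompact_cylinderDiff {a b c : V} (α : Path a c) (β : Path b c)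
    (F : Finset (Star c)) : IsCompact (cylinderDiff α β F) := by
  rw [isCompact_iff_ultrafilter_le_nhds]
  intro 𝒰 h𝒰
  rw [Filter.le_principal_iff] at h𝒰
  obtain ⟨γ, hγ, h⟩ := exists_le_nhds (Filter.mem_of_superset h𝒰 Set.sdiff_subset)
  refine ⟨γ, ⟨hγ, fun hF => ?_⟩, le_nhds_of hγ h⟩
  simp only [Set.mem_iUnion] at hF
  obtain ⟨e, he, hm⟩ := hF
  have := h e.1 e.2.toPath ∅ (by rw [cylinderDiff_empty]; exact hm)
  rw [cylinderDiff_empty] at this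
  obtain ⟨δ, h1, h2⟩ := 𝒰.nonempty_of_mem (Filter.inter_mem h𝒰 this)
  exact h1.2 (Set.mem_biUnion he h2)

/-- The graph groupoid is a Hausdorff ample groupoid. -/
instance : IsHausdorffAmple (BoundaryPath V) where
  t2Space := inferInstance
  continuous_inv := continuous_inv
  continuous_comp := continuous_comp
  locallyCompactSpace := by
    have : WeaklyLocallyCompactSpace (Arr.unitSpace (BoundaryPath V)) := by
      refine ⟨?_⟩
      rintro ⟨_, x, rfl⟩
      have hc := isCompact_cylinderDiff (Path.nil : Path x.start x.start) Path.nil ∅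
      rw [cylinderDiff_empty] at hc
      exact ⟨_, hc.image continuous_source,
        (isOpen_image_source (isOpen_cylinder _ _) subset_rfl).mem_nhds
          ⟨_, mem_cylinder_nil x, rfl⟩⟩
    infer_instance
  isLocalHomeomorph_source := by
    rw [isLocalHomeomorph_iff_isOpenEmbedding_restrict]
    intro γ
    obtain ⟨a, b, c, α, β, h⟩ := exists_mem_cylinder γ
    exact ⟨_, (isOpen_cylinder α β).mem_nhds h,
      isOpenEmbedding_source (isOpen_cylinder α β) subset_rfl⟩
  isTopologicalBasis := by
    refine TopologicalSpace.isTopologicalBasis_of_isOpen_of_nhds (fun U hU => hU.1.1) ?_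
    intro γ W hγ hW
    obtain ⟨a, b, c, α, β, h⟩ := exists_mem_cylinder γ
    obtain ⟨d, δ, F, h1, h2⟩ := exists_cylinderDiff_subset hW hγ h
    exact ⟨_, ⟨isOpenBisection_cylinderDiff _ _ _, isCompact_cylinderDiff _ _ _⟩, h1, h2⟩

end BoundaryPath

/-! ### Graph-theoretic conditions -/

/-- A set of vertices is hereditary if every edge starting in it ends in it. -/
def IsHereditary (H : Set V) : Prop :=
  ∀ ⦃a b : V⦄, (a ⟶ b) → a ∈ H → b ∈ H

/-- A set of vertices is saturated if it contains every regular vertex all of whose edges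
end in it. -/
def IsSaturated (H : Set V) : Prop :=
  ∀ a : V, IsRegularVertex a → (∀ b : V, (a ⟶ b) → b ∈ H) → a ∈ H

/-- The edges of a path. -/
def pathEdges {a : V} : ∀ {b : V}, Path a b → List (Total V)
  | _, Path.nil => []
  | _, Path.cons p e => pathEdges p ++ [⟨_, _, e⟩]

/-- A closed path of positive length is a cycle if the sources of its edges are distinct. -/
def IsCycle {a : V} (p : Path a a) : Prop :=
  0 < p.length ∧ ((pathEdges p).map Total.left).Nodup

/-- A path has an exit if some edge has the same source as, but is different from, an edge of
the path. -/
def HasExit {a b : V} (p : Path a b) : Prop :=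
  ∃ f : Total V, ∃ e ∈ pathEdges p, f.left = e.left ∧ f ≠ e

end Graph

/-! ### Semirings -/

/-- A nonzero hemiring is congruence-simple if the diagonal and the universal congruence are its
only congruences. -/
def IsCongruenceSimple (A : Type u) [NonUnitalSemiring A] : Prop :=
  Nontrivial A ∧ ∀ ρ : RingCon A, (∀ a b, ρ a b ↔ a = b) ∨ ∀ a b, ρ a b

/-- A commutative semiring is a field if it is a field in the usual sense, so in particular every
element has an additive inverse (Mathlib's `IsField` alone is the notion of a semifield). -/
def IsFieldSemiring (S : Type u) [CommSemiring S] : Prop :=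
  IsField S ∧ ∀ a : S, ∃ b : S, a + b = 0

/-- The Boolean semifield `𝔹 = ({0, 1}, ∨, ∧, 0, 1)`. -/
inductive BooleanSemifield : Type
  | zero
  | one

namespace BooleanSemifield

/-- Addition is disjunction. -/
def or : BooleanSemifield → BooleanSemifield → BooleanSemifield
  | zero, b => b
  | one, _ => one

/-- Multiplication is conjunction. -/
def and : BooleanSemifield → BooleanSemifield → BooleanSemifield
  | zero, _ => zero
  | one, b => b

instance : Zero BooleanSemifield := ⟨zero⟩

instance : One BooleanSemifield := ⟨one⟩

instance : Add BooleanSemifield := ⟨or⟩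

instance : Mul BooleanSemifield := ⟨and⟩

instance : CommSemiring BooleanSemifield where
  nsmul := nsmulRec
  add_assoc := by rintro (_ | _) (_ | _) (_ | _) <;> rfl
  zero_add := by rintro (_ | _) <;> rfl
  add_zero := by rintro (_ | _) <;> rfl
  add_comm := by rintro (_ | _) (_ | _) <;> rfl
  left_distrib := by rintro (_ | _) (_ | _) (_ | _) <;> rfl
  right_distrib := by rintro (_ | _) (_ | _) (_ | _) <;> rfl
  zero_mul := by rintro (_ | _) <;> rfl
  mul_zero := by rintro (_ | _) <;> rfl
  mul_assoc := by rintro (_ | _) (_ | _) (_ | _) <;> rfl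
  one_mul := by rintro (_ | _) <;> rfl
  mul_one := by rintro (_ | _) <;> rfl
  mul_comm := by rintro (_ | _) (_ | _) <;> rfl

end BooleanSemifield

/-!
Congruence-simplicity is studied through explicit congruences.

*Necessity.* A congruence on `S` induces one on the Steinberg algebra pointwise (`restrictCon`), so
`S` is congruence-simple; a congruence-simple commutative semiring is a field or the Boolean
semifield, depending on whether some nonzero element has an additive inverse
(`isFieldSemiring_or_boolean_of_simple`). A hereditary and saturated set `H` of vertices gives the
closed invariant set of the boundary paths that never enter `H`, and comparing functions over this
set is a congruence; from every vertex outside `H` such a boundary path starts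
(`exists_boundaryPathFrom_avoiding`). The algebra acts on the functions on the space of boundary
paths (`orbitAction`), and this action does not see the isotropy: for a cycle `p` without exit
starting at `a`, the elements `1_{Z(p, a)}` and `1_{Z(a, a)}` are different but act equally
(`hasExit_of_simple`).

*Sufficiency.* Let a congruence identify `f ≠ g`. After translation by a bisection, `f` and `g`
differ at a unit, hence they are constant, equal to `c ≠ d`, on the units in some `Z(α)`. If every
cycle has an exit, then the groupoid is topologically free in the following strong form: for every
compact set `U` of arrows, `α` has an extension `β` such that each arrow of `U` with both ends in
`Z(β)` is a unit (`avoidsIsotropy_of_isCompact`). For a cylinder `Z(μ, ν)` with `|ν| < |μ|` this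
amounts to leaving a closed path `η`: the paths `δ` with `Z(δ) ∩ η Z(δ) ≠ ∅` are the prefixes of
`ηηη…`, and an exit provides two different paths of the same length, one of which is not such a
prefix (`exists_path_of_forall_loop`). Cutting `f` and `g` down to `Z(β)` now shows that
`c 1_{Z(β)}` and `d 1_{Z(β)}` are congruent, and over a field or the Boolean semifield it follows
that `1_{Z(β)}` is congruent to `0` (`rel_zero_of_rel_smul`). So the set of the vertices `v` with
`1_{Z(v)}` congruent to `0` is nonempty (`nullVertices_nonempty`). It is hereditary and saturated,
so it contains all vertices, and as the sums of the `1_{Z(v)}` are local units, everything is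
congruent to `0`.
-/

/-! ### Congruence-simple commutative semirings -/

section Semirings

variable {S : Type w} [CommSemiring S]

/-- The congruence `a x = a y` on a commutative semiring. -/
def mulLeftCon (a : S) : RingCon S where
  r x y := a * x = a * y
  iseqv := ⟨fun _ => rfl, fun h => h.symm, fun h h' => h.trans h'⟩
  add' {x y z t} h h' := by rw [mul_add, mul_add, h, h']
  mul' {x y z t} h h' := by rw [← mul_assoc, h, mul_right_comm, h', mul_right_comm, mul_assoc]

/-- The congruence `x + i = y`, where `i` has an additive inverse. -/
def addUnitsCon (S : Type w) [CommSemiring S] : RingCon S where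
  r x y := ∃ i j : S, i + j = 0 ∧ x + i = y
  iseqv :=
    ⟨fun x => ⟨0, 0, add_zero 0, add_zero x⟩,
      fun {x y} ⟨i, j, h, e⟩ => ⟨j, i, by rw [add_comm, h], by rw [← e, add_assoc, h, add_zero]⟩,
      fun {x y z} ⟨i, j, h, e⟩ ⟨i', j', h', e'⟩ =>
        ⟨i + i', j + j', by rw [add_add_add_comm, h, h', add_zero], by rw [← e', ← e, add_assoc]⟩⟩
  add' {x y z t} := fun ⟨i, j, h, e⟩ ⟨i', j', h', e'⟩ =>
    ⟨i + i', j + j', by rw [add_add_add_comm, h, h', add_zero], by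
      rw [← e', ← e, add_add_add_comm]⟩
  mul' {x y z t} := fun ⟨i, j, h, e⟩ ⟨i', j', h', e'⟩ =>
    ⟨x * i' + i * t, x * j' + j * t, by
      rw [add_add_add_comm, ← mul_add, ← add_mul, h, h', mul_zero, zero_mul, add_zero], by
      rw [← add_assoc, ← mul_add, e', ← add_mul, e]⟩

/-- The congruence that identifies all nonzero elements of a semiring in which sums and products
of nonzero elements are nonzero. -/
def nonzeroCon (hadd : ∀ x y : S, x + y = 0 → x = 0) (hmul : ∀ x y : S, x * y = 0 → x = 0 ∨ y = 0) :
    RingCon S where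
  r x y := x = 0 ↔ y = 0
  iseqv := ⟨fun _ => Iff.rfl, fun h => h.symm, fun h h' => h.trans h'⟩
  add' {x y z t} h h' := by
    have key : ∀ x y : S, x + y = 0 ↔ x = 0 ∧ y = 0 := fun x y =>
      ⟨fun e => ⟨hadd x y e, hadd y x (by rw [add_comm, e])⟩,
        by rintro ⟨rfl, rfl⟩; exact add_zero 0⟩
    rw [key, key, h, h']
  mul' {x y z t} h h' := by
    have key : ∀ x y : S, x * y = 0 ↔ x = 0 ∨ y = 0 := fun x y =>
      ⟨hmul x y, by rintro (rfl | rfl) <;> simp⟩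
    rw [key, key, h, h']

/-- A commutative semiring with `1 ≠ 0` in which sums of nonzero elements are nonzero and all
nonzero elements are equal is the Boolean semifield. -/
theorem nonempty_ringEquiv_booleanSemifield [Nontrivial S]
    (hadd : ∀ x y : S, x + y = 0 → x = 0) (hone : ∀ x : S, x ≠ 0 → x = 1) :
    Nonempty (S ≃+* BooleanSemifield) := by
  have h11 : (1 : S) + 1 = 1 := hone _ fun h => one_ne_zero (hadd _ _ h)
  let φ : BooleanSemifield → S := fun b => match b with
    | .zero => 0
    | .one => 1
  have hφ : Function.Bijective φ := by
    constructor
    · rintro (_ | _) (_ | _) h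
      · rfl
      · exact absurd h.symm one_ne_zero
      · exact absurd h one_ne_zero
      · rfl
    · intro x
      by_cases hx : x = 0
      · exact ⟨.zero, hx.symm⟩
      · exact ⟨.one, (hone x hx).symm⟩
  refine ⟨RingEquiv.symm { Equiv.ofBijective φ hφ with map_mul' := ?_, map_add' := ?_ }⟩
  · rintro (_ | _) (_ | _)
    · exact (zero_mul (0 : S)).symm
    · exact (zero_mul (1 : S)).symm
    · exact (mul_zero (1 : S)).symm
    · exact (mul_one (1 : S)).symm
  · rintro (_ | _) (_ | _)
    · exact (add_zero (0 : S)).symm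
    · exact (zero_add (1 : S)).symm
    · exact (add_zero (1 : S)).symm
    · exact h11.symm

/-- Either some nonzero element has an additive inverse, and then all have one, or sums of nonzero
elements are nonzero, and then all nonzero elements are congruent. -/
theorem isFieldSemiring_or_boolean_of_simple [Nontrivial S]
    (h : ∀ ρ : RingCon S, (∀ a b, ρ a b ↔ a = b) ∨ ∀ a b, ρ a b) :
    IsFieldSemiring S ∨ Nonempty (S ≃+* BooleanSemifield) := by
  have hcancel : ∀ a x y : S, a ≠ 0 → a * x = a * y → x = y := by
    intro a x y ha hxy
    rcases h (mulLeftCon a) with h' | h'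
    · exact (h' x y).1 hxy
    · have : a * 1 = a * 0 := h' 1 0
      rw [mul_one, mul_zero] at this
      exact absurd this ha
  by_cases hadd : ∀ x y : S, x + y = 0 → x = 0
  · right
    have hmul : ∀ x y : S, x * y = 0 → x = 0 ∨ y = 0 := fun x y hxy =>
      or_iff_not_imp_left.2 fun hx => hcancel x y 0 hx (by rw [hxy, mul_zero])
    refine nonempty_ringEquiv_booleanSemifield hadd fun x hx => ?_
    rcases h (nonzeroCon hadd hmul) with h' | h'
    · exact (h' x 1).1 (iff_of_false hx one_ne_zero)
    · have : (1 : S) = 0 ↔ (0 : S) = 0 := h' 1 0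
      exact absurd (this.2 rfl) one_ne_zero
  · left
    push Not at hadd
    obtain ⟨i, j, hij, hi⟩ := hadd
    have hneg : ∀ a : S, ∃ b : S, a + b = 0 := by
      intro a
      rcases h (addUnitsCon S) with h' | h'
      · exact absurd ((h' 0 i).1 ⟨i, j, hij, zero_add i⟩).symm hi
      · obtain ⟨i, j, hij, e⟩ := h' 0 a
        rw [zero_add] at e
        exact ⟨j, by rw [← e, hij]⟩
    refine ⟨⟨exists_pair_ne S, mul_comm, fun {a} ha => ?_⟩, hneg⟩
    -- The elements that are congruent modulo the principal ideal `a S`.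
    let ρ : RingCon S :=
      { r := fun x y => ∃ s, x = y + a * s
        iseqv := ⟨fun x => ⟨0, by simp⟩, fun {x y} ⟨s, e⟩ => by
          obtain ⟨t, ht⟩ := hneg s
          exact ⟨t, by rw [e, add_assoc, ← mul_add, ht, mul_zero, add_zero]⟩,
          fun {x y z} ⟨s, e⟩ ⟨t, e'⟩ => ⟨t + s, by rw [e, e', mul_add, add_assoc]⟩⟩
        add' := fun {x y z t} ⟨s, e⟩ ⟨s', e'⟩ => ⟨s + s', by rw [e, e', mul_add, add_add_add_comm]⟩
        mul' := fun {x y z t} ⟨s, e⟩ ⟨s', e'⟩ =>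
          ⟨y * s' + s * t + s * (a * s'), by rw [e, e']; ring⟩ }
    rcases h ρ with h' | h'
    · exact absurd ((h' a 0).1 ⟨1, by simp⟩) ha
    · obtain ⟨s, e⟩ := h' 1 0
      exact ⟨s, by rw [e, zero_add]⟩

/-- Over a field or the Boolean semifield any two distinct scalars are mapped to `0` and `1`, in
one order or the other, by an affine map. -/
theorem exists_affine_of_ne (hS : IsFieldSemiring S ∨ Nonempty (S ≃+* BooleanSemifield)) {c d : S}
    (hcd : c ≠ d) : ∃ s t : S, s * c + t = 1 ∧ s * d + t = 0 ∨ s * c + t = 0 ∧ s * d + t = 1 := by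
  rcases hS with ⟨hf, hneg⟩ | ⟨⟨φ⟩⟩
  · obtain ⟨d', hd⟩ := hneg d
    have hne : c + d' ≠ 0 := fun h => hcd <| by
      rw [← add_zero c, ← hd, add_comm d, ← add_assoc, h, zero_add]
    obtain ⟨s, hs⟩ := hf.mul_inv_cancel hne
    exact ⟨s, s * d', Or.inl ⟨by rw [← mul_add, mul_comm, hs], by rw [← mul_add, hd, mul_zero]⟩⟩
  · have key : ∀ x : S, x = 0 ∨ x = 1 := by
      intro x
      rw [← φ.map_eq_zero_iff, ← φ.map_eq_one_iff]
      rcases φ x with _ | _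
      exacts [Or.inl rfl, Or.inr rfl]
    refine ⟨1, 0, ?_⟩
    simp only [one_mul, add_zero]
    rcases key c with rfl | rfl <;> rcases key d with rfl | rfl
    · exact absurd rfl hcd
    · exact Or.inr ⟨rfl, rfl⟩
    · exact Or.inl ⟨rfl, rfl⟩
    · exact absurd rfl hcd

end Semirings

/-! ### Elements and congruences of Steinberg algebras -/

section Evaluation

open Arr

variable {S : Type w} [CommSemiring S] {X : Type u} [Groupoid.{v} X]

theorem Factorization.srcObj {γ : Arr X} (p : Factorization γ) : p.1.2.srcObj = γ.srcObj := by
  obtain ⟨⟨α, β⟩, e, rfl⟩ := p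
  rfl

theorem Arr.comp_one {α : Arr X} {x : X} (h : α.srcObj = x) : α.comp (Arr.one x) h = α := by
  obtain ⟨a, b, α⟩ := α
  obtain rfl : b = x := h
  simp [comp, one]

theorem Arr.one_comp {α : Arr X} {x : X} (h : x = α.rngObj) : (Arr.one x).comp α h = α := by
  obtain ⟨a, b, α⟩ := α
  obtain rfl : x = a := h
  simp [comp, one]

theorem Arr.inv_comp_self (α : Arr X) : α.inv.comp α rfl = Arr.one α.srcObj := by
  simp [comp, Arr.inv, one]

/-- Left multiplication by the characteristic function of a bisection is translation. -/
theorem convolution_indicator_left (U : Set (Arr X)) (hU : Set.InjOn Arr.range U)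
    (f : Arr X → S) {α γ : Arr X} (hα : α ∈ U) (h : α.srcObj = γ.rngObj) :
    convolution (U.indicator 1) f (α.comp γ h) = f γ := by
  rw [convolution, finsum_eq_single _ ⟨(α, γ), h, rfl⟩]
  · simp [hα]
  · intro p hp
    by_cases h1 : p.1.1 ∈ U
    · exact absurd (Factorization.ext_fst (hU h1 hα (range_eq_iff.2 p.rngObj))) hp
    · simp [h1]

/-- Multiplication by the indicator functions of sets of units is restriction. -/
theorem convolution_indicator_unit_left {W : Set (Arr X)} (hW : W ⊆ unitSpace X) (f : Arr X → S)
    (γ : Arr X) [Decidable (Arr.one γ.rngObj ∈ W)] :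
    convolution (W.indicator 1) f γ = if Arr.one γ.rngObj ∈ W then f γ else 0 := by
  split_ifs with h
  · have := convolution_indicator_left W (f := f) ?_ h (rfl : (Arr.one γ.rngObj).srcObj = γ.rngObj)
    · rwa [Arr.one_comp rfl] at this
    · rintro α hα β hβ e
      obtain ⟨x, rfl⟩ := hW hα
      obtain ⟨y, rfl⟩ := hW hβ
      rw [show x = y from range_eq_iff.1 e]
  · refine finsum_eq_zero_of_forall_eq_zero fun p => ?_
    by_cases h1 : p.1.1 ∈ W
    · obtain ⟨x, hx⟩ := hW h1
      refine absurd ?_ h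
      rw [← p.rngObj, ← hx]
      change Arr.one x ∈ W
      rwa [hx]
    · simp [h1]

theorem Factorization.ext_snd {γ : Arr X} {p q : Factorization γ} (h : p.1.2 = q.1.2) : p = q := by
  obtain ⟨⟨α, β⟩, e, rfl⟩ := p
  obtain ⟨⟨α', β'⟩, e', h'⟩ := q
  obtain rfl : β = β' := h
  refine Factorization.ext_fst ?_
  have key : ∀ (α : Arr X) (e : α.srcObj = β.rngObj), (α.comp β e).comp β.inv rfl = α := by
    intro α e
    obtain ⟨x, y, a⟩ := α
    obtain ⟨y', z, b⟩ := β
    obtain rfl : y = y' := e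
    simp [comp, Arr.inv]
  dsimp only
  dsimp only at h'
  rw [← key α e, ← key α' e']
  congr 1
  exact h'.symm

theorem convolution_indicator_unit_right {W : Set (Arr X)} (hW : W ⊆ unitSpace X) (f : Arr X → S)
    (γ : Arr X) [Decidable (Arr.one γ.srcObj ∈ W)] :
    convolution f (W.indicator 1) γ = if Arr.one γ.srcObj ∈ W then f γ else 0 := by
  have hunit : ∀ p : Factorization γ, p.1.2 ∈ W → p.1.2 = Arr.one γ.srcObj := by
    intro p hp
    obtain ⟨x, hx⟩ := hW hp
    have := p.srcObj
    rw [← hx] at this ⊢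
    exact congrArg _ this
  split_ifs with h
  · rw [convolution, finsum_eq_single _ ⟨(γ, Arr.one γ.srcObj), rfl, Arr.comp_one rfl⟩]
    · simp [h]
    · intro p hp
      by_cases h1 : p.1.2 ∈ W
      · exact absurd (Factorization.ext_snd (hunit p h1)) hp
      · simp [h1]
  · refine finsum_eq_zero_of_forall_eq_zero fun p => ?_
    by_cases h1 : p.1.2 ∈ W
    · exact absurd (hunit p h1 ▸ h1) h
    · simp [h1]

/-- The action of a function on the groupoid on the functions on the set of objects. -/
noncomputable def orbitAction (f : Arr X → S) (φ : X → S) (x : X) : S :=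
  ∑ᶠ γ : {γ : Arr X // γ.rngObj = x}, f γ.1 * φ γ.1.srcObj

theorem orbitAction_zero (φ : X → S) : orbitAction 0 φ = 0 := by
  funext x; simp [orbitAction]

theorem orbitAction_apply_zero (f : Arr X → S) : orbitAction f 0 = 0 := by
  funext x; simp [orbitAction]

theorem orbitAction_indicator {U : Set (Arr X)} (hU : Set.InjOn Arr.range U) (φ : X → S)
    {γ : Arr X} (hγ : γ ∈ U) :
    orbitAction (U.indicator 1) φ γ.rngObj = φ γ.srcObj := by
  rw [orbitAction, finsum_eq_single _ ⟨γ, rfl⟩]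
  · simp [hγ]
  · intro δ hδ
    by_cases h1 : δ.1 ∈ U
    · exact absurd (Subtype.ext (hU h1 hγ (range_eq_iff.2 δ.2))) hδ
    · simp [h1]

theorem orbitAction_indicator_of_notMem {U : Set (Arr X)} (φ : X → S) {x : X}
    (hx : ∀ γ ∈ U, γ.rngObj ≠ x) : orbitAction (U.indicator 1) φ x = 0 := by
  refine finsum_eq_zero_of_forall_eq_zero fun δ => ?_
  have : δ.1 ∉ U := fun h => hx _ h δ.2
  simp [this]

variable [TopologicalSpace (Arr X)]

theorem isLocallyConstant_of_mem_steinbergSubmodule [T2Space (Arr X)] {f : Arr X → S}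
    (hf : f ∈ steinbergSubmodule S X) : IsLocallyConstant f := by
  classical
  induction hf using Submodule.span_induction with
  | mem f hf =>
    obtain ⟨U, hU, rfl⟩ := hf
    exact (LocallyConstant.charFn S ⟨hU.2.isClosed, hU.1.1⟩).isLocallyConstant
  | zero => exact IsLocallyConstant.const 0
  | add f g _ _ hf hg => exact hf.add hg
  | smul c f _ hf => exact hf.comp (c • ·)

theorem finite_support_orbitAction {f : Arr X → S} (hf : f ∈ steinbergSubmodule S X) (φ : X → S)
    (x : X) :
    (Function.support fun γ : {γ : Arr X // γ.rngObj = x} => f γ.1 * φ γ.1.srcObj).Finite := by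
  refine Set.Finite.of_finite_image (f := Subtype.val) ((finite_support hf x).subset ?_)
    Subtype.val_injective.injOn
  rintro _ ⟨γ, hγ, rfl⟩
  exact ⟨γ.2, fun h => hγ (by simp [h])⟩

theorem orbitAction_add {f g : Arr X → S} (hf : f ∈ steinbergSubmodule S X)
    (hg : g ∈ steinbergSubmodule S X) (φ : X → S) :
    orbitAction (f + g) φ = orbitAction f φ + orbitAction g φ := by
  funext x
  simp only [orbitAction, Pi.add_apply, add_mul]
  exact finsum_add_distrib (finite_support_orbitAction hf φ x) (finite_support_orbitAction hg φ x)

theorem orbitAction_smul {f : Arr X → S} (hf : f ∈ steinbergSubmodule S X) (c : S) (φ : X → S) :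
    orbitAction (c • f) φ = c • orbitAction f φ := by
  funext x
  simp only [orbitAction, Pi.smul_apply, smul_eq_mul, mul_assoc]
  exact (mul_finsum' _ _ (finite_support_orbitAction hf φ x)).symm

theorem orbitAction_apply_add {f : Arr X → S} (hf : f ∈ steinbergSubmodule S X) (φ ψ : X → S) :
    orbitAction f (φ + ψ) = orbitAction f φ + orbitAction f ψ := by
  funext x
  simp only [orbitAction, Pi.add_apply, mul_add]
  exact finsum_add_distrib (finite_support_orbitAction hf φ x) (finite_support_orbitAction hf ψ x)

theorem orbitAction_apply_smul {f : Arr X → S} (hf : f ∈ steinbergSubmodule S X) (c : S)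
    (φ : X → S) : orbitAction f (c • φ) = c • orbitAction f φ := by
  funext x
  simp only [orbitAction, Pi.smul_apply, smul_eq_mul, mul_left_comm _ c]
  exact (mul_finsum' _ _ (finite_support_orbitAction hf φ x)).symm

variable [IsHausdorffAmple X]

theorem orbitAction_convolution {f g : Arr X → S} (hf : f ∈ steinbergSubmodule S X)
    (hg : g ∈ steinbergSubmodule S X) (φ : X → S) :
    orbitAction (convolution f g) φ = orbitAction f (orbitAction g φ) := by
  induction hf using Submodule.span_induction with
  | mem f hf =>
    have hf' : f ∈ steinbergSubmodule S X := Submodule.subset_span hf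
    induction hg using Submodule.span_induction with
    | mem g hg =>
      obtain ⟨U, hU, rfl⟩ := hf
      obtain ⟨V, hV, rfl⟩ := hg
      rw [convolution_indicator hU]
      funext x
      by_cases hx : ∃ α ∈ U, α.rngObj = x
      · obtain ⟨α, hα, rfl⟩ := hx
        rw [orbitAction_indicator hU.1.injOn_range _ hα]
        by_cases hy : ∃ β ∈ V, β.rngObj = α.srcObj
        · obtain ⟨β, hβ, h⟩ := hy
          rw [← h, orbitAction_indicator hV.1.injOn_range _ hβ]
          exact orbitAction_indicator (γ := α.comp β h.symm) (setMul_mem hU hV).1.injOn_range φ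
            ⟨α, hα, β, hβ, h.symm, rfl⟩
        · push Not at hy
          rw [orbitAction_indicator_of_notMem _ hy, orbitAction_indicator_of_notMem]
          rintro _ ⟨α', hα', β, hβ, h, rfl⟩ e
          obtain rfl := hU.1.injOn_range hα' hα (range_eq_iff.2 e)
          exact hy β hβ h.symm
      · push Not at hx
        rw [orbitAction_indicator_of_notMem _ hx, orbitAction_indicator_of_notMem]
        rintro _ ⟨α, hα, β, hβ, h, rfl⟩
        exact hx α hα
    | zero => rw [convolution_zero_right, orbitAction_zero, orbitAction_apply_zero]
    | add g h hg hh ihg ihh =>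
      rw [convolution_add_right hf', orbitAction_add (convolution_mem hf' hg)
        (convolution_mem hf' hh), ihg, ihh, orbitAction_add hg hh, orbitAction_apply_add hf']
    | smul c g hg ih =>
      rw [convolution_smul_right hf', orbitAction_smul (convolution_mem hf' hg), ih,
        orbitAction_smul hg, orbitAction_apply_smul hf']
  | zero => rw [convolution_zero_left, orbitAction_zero, orbitAction_zero]
  | add f h hf hh ihf ihh =>
    rw [convolution_add_left hf hh, orbitAction_add (convolution_mem hf hg)
      (convolution_mem hh hg), ihf, ihh, orbitAction_add hf hh]
  | smul c f hf ih =>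
    rw [convolution_smul_left hf, orbitAction_smul (convolution_mem hf hg), ih,
      orbitAction_smul hf]

namespace SteinbergAlgebra

/-- The congruence on the Steinberg algebra that identifies two elements if they act equally on
the functions on the set of objects. It forgets the isotropy of the groupoid. -/
def orbitCon (S : Type w) [CommSemiring S] (X : Type u) [Groupoid.{v} X]
    [TopologicalSpace (Arr X)] [IsHausdorffAmple X] : RingCon (SteinbergAlgebra S X) where
  r f g := ∀ φ : X → S, orbitAction f.1 φ = orbitAction g.1 φ
  iseqv := ⟨fun _ _ => rfl, fun h φ => (h φ).symm, fun h h' φ => (h φ).trans (h' φ)⟩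
  add' {f f' g g'} h h' φ :=
    (orbitAction_add f.2 g.2 φ).trans <| (congrArg₂ _ (h φ) (h' φ)).trans
      (orbitAction_add f'.2 g'.2 φ).symm
  mul' {f f' g g'} h h' φ :=
    (orbitAction_convolution f.2 g.2 φ).trans <| by
      rw [h' φ, h]
      exact (orbitAction_convolution f'.2 g'.2 φ).symm

/-- The congruence on the Steinberg algebra that compares, modulo a congruence on the semiring, the
values on the arrows over an invariant set of objects. -/
def restrictCon (ρ : RingCon S) (D : Set X) (hD : ∀ γ : Arr X, γ.rngObj ∈ D → γ.srcObj ∈ D) :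
    RingCon (SteinbergAlgebra S X) where
  r f g := ∀ γ : Arr X, γ.rngObj ∈ D → ρ (f.1 γ) (g.1 γ)
  iseqv := ⟨fun _ _ _ => ρ.refl _, fun h γ hγ => ρ.symm (h γ hγ),
    fun h h' γ hγ => ρ.trans (h γ hγ) (h' γ hγ)⟩
  add' h h' γ hγ := ρ.add (h γ hγ) (h' γ hγ)
  mul' {f f' g g'} h h' γ hγ := by
    classical
    have h1 := finite_support_factorization f.2 g.1 γ
    have h2 := finite_support_factorization f'.2 g'.1 γ
    change ρ (∑ᶠ p : Factorization γ, f.1 p.1.1 * g.1 p.1.2)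
      (∑ᶠ p : Factorization γ, f'.1 p.1.1 * g'.1 p.1.2)
    rw [finsum_eq_sum_of_support_subset (s := h1.toFinset ∪ h2.toFinset) _ (by
        intro p hp; simp only [Finset.coe_union, Set.Finite.coe_toFinset]; exact Or.inl hp),
      finsum_eq_sum_of_support_subset (s := h1.toFinset ∪ h2.toFinset) _ (by
        intro p hp; simp only [Finset.coe_union, Set.Finite.coe_toFinset]; exact Or.inr hp)]
    refine ρ.finsetSum _ fun p _ => ρ.mul (h _ (p.rngObj.symm ▸ hγ)) (h' _ ?_)
    obtain ⟨e, -⟩ := p.2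
    exact e ▸ hD _ (p.rngObj.symm ▸ hγ)

variable (S) in
/-- The characteristic function of a compact open bisection, as an element of the Steinberg
algebra. -/
noncomputable def charFun (U : Set (Arr X)) (hU : U ∈ compactOpenBisections X) :
    SteinbergAlgebra S X :=
  ⟨U.indicator 1, Submodule.subset_span ⟨U, hU, rfl⟩⟩

theorem charFun_mul {U V : Set (Arr X)} (hU : U ∈ compactOpenBisections X)
    (hV : V ∈ compactOpenBisections X) :
    charFun S U hU * charFun S V hV = charFun S (setMul U V) (setMul_mem hU hV) :=
  Subtype.ext (convolution_indicator hU)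

theorem smul_mul_smul_charFun {W : Set (Arr X)} (hW : W ∈ compactOpenBisections X)
    (hWW : setMul W W = W) (c d : S) :
    (c • charFun S W hW) * (d • charFun S W hW) = (c * d) • charFun S W hW := by
  refine Subtype.ext ?_
  change convolution (c • W.indicator 1) (d • W.indicator 1) = (c * d) • W.indicator (1 : Arr X → S)
  have hm : W.indicator (1 : Arr X → S) ∈ steinbergSubmodule S X :=
    Submodule.subset_span ⟨W, hW, rfl⟩
  rw [convolution_smul_left hm, convolution_smul_right hm, convolution_indicator hW, hWW,
    mul_smul]

/-- Over a field or the Boolean semifield, a congruence that identifies two different multiples of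
an idempotent `1_W` identifies `1_W` with `0`. -/
theorem rel_zero_of_rel_smul (hS : IsFieldSemiring S ∨ Nonempty (S ≃+* BooleanSemifield))
    (ρ : RingCon (SteinbergAlgebra S X)) {W : Set (Arr X)} (hW : W ∈ compactOpenBisections X)
    (hWW : setMul W W = W) {c d : S} (hcd : c ≠ d)
    (h : ρ (c • charFun S W hW) (d • charFun S W hW)) : ρ (charFun S W hW) 0 := by
  obtain ⟨s, t, hst⟩ := exists_affine_of_ne hS hcd
  have key := ρ.add (ρ.mul (ρ.refl (s • charFun S W hW)) h) (ρ.refl (t • charFun S W hW))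
  rw [smul_mul_smul_charFun hW hWW, smul_mul_smul_charFun hW hWW, ← add_smul, ← add_smul] at key
  rcases hst with ⟨h1, h2⟩ | ⟨h1, h2⟩
  · rwa [h1, h2, one_smul, zero_smul] at key
  · rw [h1, h2, one_smul, zero_smul] at key
    exact ρ.symm key

end SteinbergAlgebra

end Evaluation

/-! ### Paths and boundary paths -/

section Paths

open Quiver

variable {V : Type u} [Quiver.{v} V]

theorem IsHereditary.mem_of_path {H : Set V} (hH : IsHereditary H) {a b : V} (p : Path a b)
    (ha : a ∈ H) : b ∈ H := by
  induction p with
  | nil => exact ha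
  | cons p e ih => exact hH e ih

theorem isHereditary_empty : IsHereditary (∅ : Set V) := fun _ _ _ h => h

theorem isSaturated_empty : IsSaturated (∅ : Set V) := fun _ ha h => by
  obtain ⟨⟨b, e⟩⟩ := ha.1
  exact h b e

theorem isRegularVertex_of_not_isSingularVertex {a : V} (h : ¬ IsSingularVertex a) :
    IsRegularVertex a := by
  rw [IsSingularVertex, not_or, not_isEmpty_iff, not_infinite_iff_finite] at h
  exact h

/-- From a vertex outside a hereditary and saturated set starts a boundary path that never enters
the set. -/
theorem exists_boundaryPathFrom_avoiding {H : Set V} (hH : IsHereditary H) (hs : IsSaturated H)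
    {a : V} (ha : a ∉ H) :
    ∃ x : BoundaryPathFrom a, ∀ (b : V) (p : Path a b) (w : BoundaryPathFrom b),
      x = .concat p w → b ∉ H := by
  by_cases hsing : ∃ (b : V) (_ : Path a b), b ∉ H ∧ IsSingularVertex b
  · obtain ⟨b, p, hb, hb'⟩ := hsing
    refine ⟨.fin p hb', fun c q w h hc => hb ?_⟩
    cases w with
    | @fin d r hd =>
      rw [BoundaryPathFrom.concat_fin] at h
      injection h with h1
      subst h1
      exact hH.mem_of_path r hc
    | inf q' hq' hc' =>
      obtain ⟨_, _, _, h'⟩ := BoundaryPathFrom.concat_inf q q' hq' hc'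
      rw [h'] at h
      cases h
  · push Not at hsing
    have hnext : ∀ (b : V), Path a b → b ∉ H → ∃ e : Star b, e.1 ∉ H := by
      intro b p hb
      by_contra! hc
      exact hb (hs b (isRegularVertex_of_not_isSingularVertex (hsing b p hb))
        fun c e => hc ⟨c, e⟩)
    choose e he using hnext
    -- No singular vertex outside `H` is reachable, so edges outside `H` can be chosen for ever.
    let st := Σ b : V, {_p : Path a b // b ∉ H}
    let next : st → st := fun s =>
      ⟨(e s.1 s.2.1 s.2.2).1, s.2.1.cons (e s.1 s.2.1 s.2.2).2, he s.1 s.2.1 s.2.2⟩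
    let s : ℕ → st := fun n => Nat.rec ⟨a, Path.nil, ha⟩ (fun _ => next) n
    let q : ℕ → Total V := fun n =>
      ⟨(s n).1, (s (n + 1)).1, (e (s n).1 (s n).2.1 (s n).2.2).2⟩
    refine ⟨.inf q (fun _ => rfl) rfl, fun b p w h => ?_⟩
    obtain ⟨q', hq', hb, -, hi⟩ := BoundaryPathFrom.concat_eq_inf p w h.symm
    rw [← hb, hi 0]
    exact (s (p.length + 0)).2.2

instance (a : V) : Nonempty (BoundaryPathFrom a) :=
  ⟨(exists_boundaryPathFrom_avoiding isHereditary_empty isSaturated_empty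
    (Set.notMem_empty a)).choose⟩

/-- The power of a closed path. -/
def loopPow {b : V} (η : Path b b) : ℕ → Path b b
  | 0 => Path.nil
  | n + 1 => η.comp (loopPow η n)

theorem length_loopPow {b : V} (η : Path b b) (n : ℕ) :
    (loopPow η n).length = n * η.length := by
  induction n with
  | zero => simp [loopPow]
  | succ n ih => rw [loopPow, Path.length_comp, ih]; ring

/-- If `δ` is a prefix of `η δ` then it is a prefix of all high powers of the closed path `η`. -/
theorem exists_loopPow_eq_comp {b d : V} {η : Path b b} (hη : 0 < η.length) {δ : Path b d}
    {u u' : BoundaryPathFrom d}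
    (h : BoundaryPathFrom.concat δ u = .concat η (.concat δ u')) {n : ℕ} (hn : δ.length ≤ n) :
    ∃ r : Path d b, loopPow η n = δ.comp r := by
  rw [← BoundaryPathFrom.concat_comp] at h
  obtain ⟨t, ht, -⟩ := BoundaryPathFrom.prefix_of_concat_eq _ _ _ _ h (by simp)
  have hs : ∀ n, ∃ s : Path d d, (loopPow η n).comp δ = δ.comp s := by
    intro n
    induction n with
    | zero => exact ⟨Path.nil, by simp [loopPow]⟩
    | succ n ih =>
      obtain ⟨s, hs⟩ := ih
      exact ⟨t.comp s, by rw [loopPow, Path.comp_assoc, hs, ← Path.comp_assoc, ht, Path.comp_assoc]⟩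
  obtain ⟨s, hs⟩ := hs n
  obtain ⟨r, hr, -⟩ := BoundaryPathFrom.prefix_of_concat_eq δ (loopPow η n) (.concat s u)
    (.concat δ u) (by rw [← BoundaryPathFrom.concat_comp, ← BoundaryPathFrom.concat_comp, hs])
    (by rw [length_loopPow]; exact hn.trans (Nat.le_mul_of_pos_right n hη))
  exact ⟨r, hr⟩

/-- For a closed path `η`, the paths `δ` with `Z(δ) ∩ η Z(δ) ≠ ∅` are the prefixes of `ηηη…`;
so they are determined by their lengths. -/
theorem eq_of_concat_eq_concat_loop {b d d' : V} {η : Path b b} (hη : 0 < η.length)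
    {δ : Path b d} {δ' : Path b d'} (hl : δ.length = δ'.length) {u₁ u₂ : BoundaryPathFrom d}
    {u₁' u₂' : BoundaryPathFrom d'}
    (h : BoundaryPathFrom.concat δ u₁ = .concat η (.concat δ u₂))
    (h' : BoundaryPathFrom.concat δ' u₁' = .concat η (.concat δ' u₂')) :
    (⟨d, δ⟩ : Σ d : V, Path b d) = ⟨d', δ'⟩ := by
  obtain ⟨r, hr⟩ := exists_loopPow_eq_comp hη h le_rfl
  obtain ⟨r', hr'⟩ := exists_loopPow_eq_comp hη h' hl.ge
  have z : BoundaryPathFrom b := Classical.arbitrary _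
  obtain ⟨s, rfl, -⟩ := BoundaryPathFrom.prefix_of_concat_eq δ δ' (.concat r z) (.concat r' z)
    (by rw [← BoundaryPathFrom.concat_comp, ← BoundaryPathFrom.concat_comp, ← hr, ← hr']) hl.le
  cases s with
  | nil => rfl
  | cons s e =>
    rw [Path.length_comp, Path.length_cons] at hl
    omega

theorem exists_eq_comp_of_mem_pathEdges {a b : V} {p : Path a b} {e : Total V}
    (he : e ∈ pathEdges p) :
    ∃ (p₁ : Path a e.left) (p₂ : Path e.right b), p = (p₁.cons e.hom).comp p₂ := by
  induction p with
  | nil => simp [pathEdges] at he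
  | @cons c d p f ih =>
    rw [pathEdges, List.mem_append, List.mem_singleton] at he
    rcases he with he | rfl
    · obtain ⟨p₁, p₂, rfl⟩ := ih he
      exact ⟨p₁, p₂.cons f, rfl⟩
    · exact ⟨p, Path.nil, rfl⟩

theorem exists_subloop_of_not_nodup {a b : V} {p : Path a b}
    (h : ¬ ((pathEdges p).map Total.left).Nodup) :
    ∃ (c : V) (q₁ : Path a c) (q₂ : Path c c) (q₃ : Path c b),
      0 < q₂.length ∧ 0 < q₃.length ∧ p = q₁.comp (q₂.comp q₃) := by
  induction p with
  | nil => simp [pathEdges] at h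
  | @cons c d p f ih =>
    by_cases hp : ((pathEdges p).map Total.left).Nodup
    · have hc : c ∈ (pathEdges p).map Total.left := by
        by_contra hc
        refine h ?_
        rw [pathEdges, List.map_append, List.map_singleton]
        exact List.nodup_append.2 ⟨hp, List.nodup_singleton _, fun x hx y hy => by
          rw [List.mem_singleton] at hy
          subst hy
          exact fun e => hc (e ▸ hx)⟩
      obtain ⟨e, he, rfl⟩ := List.mem_map.1 hc
      obtain ⟨p₁, p₂, rfl⟩ := exists_eq_comp_of_mem_pathEdges he
      refine ⟨_, p₁, e.hom.toPath.comp p₂, f.toPath, by simp, by simp, ?_⟩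
      rw [← Path.comp_assoc, ← Path.comp_assoc]
      rfl
    · obtain ⟨c, q₁, q₂, q₃, h2, h3, rfl⟩ := ih hp
      exact ⟨c, q₁, q₂, q₃.cons f, h2, by simp, rfl⟩

/-- If every cycle has an exit, then at a vertex on a closed path start two different paths of
the same length. -/
theorem exists_ne_path_of_loop (hL : ∀ (a : V) (p : Path a a), IsCycle p → HasExit p) {b : V}
    (η : Path b b) (hη : 0 < η.length) :
    ∃ (d d' : V) (δ : Path b d) (δ' : Path b d'), δ.length = δ'.length ∧
      (⟨d, δ⟩ : Σ d : V, Path b d) ≠ ⟨d', δ'⟩ := by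
  -- If `η` is not a cycle, a proper closed subpath can be cut out of it.
  induction hn : η.length using Nat.strong_induction_on generalizing η with
  | _ n ih =>
    by_cases hnd : ((pathEdges η).map Total.left).Nodup
    · obtain ⟨⟨l, r, f⟩, ⟨l', r', e⟩, he, hl, hne⟩ := hL b η ⟨hη, hnd⟩
      obtain rfl : l = l' := hl
      obtain ⟨p₁, p₂, -⟩ := exists_eq_comp_of_mem_pathEdges he
      refine ⟨r, r', p₁.cons f, p₁.cons e, rfl, fun h => hne ?_⟩
      cases h
      rfl
    · obtain ⟨c, q₁, q₂, q₃, h2, h3, rfl⟩ := exists_subloop_of_not_nodup hnd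
      rw [Path.length_comp, Path.length_comp] at hn
      refine ih (q₁.comp q₃).length ?_ (q₁.comp q₃) ?_ rfl
      · rw [Path.length_comp]; omega
      · rw [Path.length_comp]; omega

theorem exists_path_of_forall_loop (hL : ∀ (a : V) (p : Path a a), IsCycle p → HasExit p) {b : V}
    (η : Path b b) (hη : 0 < η.length) :
    ∃ (d : V) (δ : Path b d), ∀ u u' : BoundaryPathFrom d,
      BoundaryPathFrom.concat δ u ≠ .concat η (.concat δ u') := by
  by_contra! hc
  obtain ⟨d, d', δ, δ', hl, hne⟩ := exists_ne_path_of_loop hL η hη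
  obtain ⟨u₁, u₂, h⟩ := hc d δ
  obtain ⟨u₁', u₂', h'⟩ := hc d' δ'
  exact hne (eq_of_concat_eq_concat_loop hη hl h h')

theorem exists_path_length_eq {b : V} (h : ∀ (d : V), Path b d → Nonempty (Star d)) (n : ℕ) :
    ∃ (d : V) (δ : Path b d), δ.length = n := by
  induction n with
  | zero => exact ⟨b, Path.nil, rfl⟩
  | succ n ih =>
    obtain ⟨d, δ, hδ⟩ := ih
    obtain ⟨⟨t, e⟩⟩ := h d δ
    exact ⟨t, δ.cons e, by simp [hδ]⟩

theorem length_eq_zero_of_concat_fin {b d : V} {q : Path b b} {p : Path b d}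
    {hd : IsSingularVertex d} (h : BoundaryPathFrom.fin p hd = .concat q (.fin p hd)) :
    q.length = 0 := by
  rw [BoundaryPathFrom.concat_fin] at h
  injection h with _ h
  have := congrArg Path.length h
  rw [Path.length_comp] at this
  omega

theorem exists_next_edge {a b : V} {p : Path a b} {e : Total V} (he : e ∈ pathEdges p) :
    e.right = b ∨ ∃ e' ∈ pathEdges p, e'.left = e.right := by
  induction p with
  | nil => simp [pathEdges] at he
  | @cons c d p f ih =>
    rw [pathEdges, List.mem_append, List.mem_singleton] at he
    rcases he with he | rfl
    · right
      rcases ih he with h | ⟨e', he', h⟩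
      · exact ⟨⟨c, d, f⟩, by simp [pathEdges], h.symm⟩
      · exact ⟨e', by simp [pathEdges, he'], h⟩
    · exact Or.inl rfl

theorem exists_first_edge {a b : V} {p : Path a b} (hp : 0 < p.length) :
    ∃ e ∈ pathEdges p, e.left = a := by
  induction p with
  | nil => simp at hp
  | @cons c d p f ih =>
    rcases Nat.eq_zero_or_pos p.length with h0 | h0
    · obtain rfl := p.eq_of_length_zero h0
      exact ⟨⟨a, d, f⟩, by simp [pathEdges], rfl⟩
    · obtain ⟨e, he, h⟩ := ih h0
      exact ⟨e, by simp [pathEdges, he], h⟩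

/-- On a closed path without exit there is only one boundary path. -/
theorem boundaryPathFrom_eq_of_not_hasExit {a : V} {p : Path a a} (hp : 0 < p.length)
    (hex : ¬ HasExit p) (x y : BoundaryPathFrom a) : x = y := by
  have huniq : ∀ f : Total V, ∀ e ∈ pathEdges p, f.left = e.left → f = e := by
    intro f e he h
    by_contra hne
    exact hex ⟨f, e, he, h, hne⟩
  -- Every vertex that can be reached from `a` lies on `p`.
  have hC : ∀ {c : V}, Path a c → ∃ e ∈ pathEdges p, e.left = c := by
    intro c q
    induction q with
    | nil => exact exists_first_edge hp
    | @cons c d q f ih =>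
      obtain ⟨⟨l, r, e⟩, he, h⟩ := ih
      dsimp only at h
      subst h
      cases huniq ⟨_, d, f⟩ _ he rfl
      rcases exists_next_edge he with h | h
      · dsimp only at h
        subst h
        exact exists_first_edge hp
      · exact h
  have hpre : ∀ (x : BoundaryPathFrom a) {c : V} (q : Path a c), ∃ w, x = .concat q w := by
    intro x c q
    induction q with
    | nil => exact ⟨x, rfl⟩
    | @cons c d q f ih =>
      obtain ⟨w, rfl⟩ := ih
      obtain ⟨e, he, rfl⟩ := hC q
      obtain ⟨h, -⟩ | ⟨d', f', y, rfl⟩ := w.eq_fin_nil_or_cons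
      · have hsub : Subsingleton (Star e.left) := by
          refine ⟨?_⟩
          rintro ⟨b, g⟩ ⟨b', g'⟩
          have h := (huniq ⟨_, b, g⟩ e he rfl).trans (huniq ⟨_, b', g'⟩ e he rfl).symm
          cases h
          rfl
        rcases h with h | h
        · exact (h.false ⟨d, f⟩).elim
        · exact (not_finite (Star e.left)).elim
      · have h := (huniq ⟨_, d, f⟩ e he rfl).trans (huniq ⟨_, d', f'⟩ e he rfl).symm
        cases h
        exact ⟨y, rfl⟩
  exact BoundaryPathFrom.ext_prefix x y fun b q => iff_of_true (hpre x q) (hpre y q)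

end Paths

/-! ### Topological freeness of the graph groupoid -/

section Effective

open Quiver BoundaryPath

variable {V : Type u} [Quiver.{v} V]

/-- A set of arrows avoids isotropy generically if every basic open set `Z(α)` of boundary paths
contains some `Z(αδ)` such that all arrows of the set with both ends in `Z(αδ)` are units. -/
def AvoidsIsotropy (U : Set (Arr (BoundaryPath V))) : Prop :=
  ∀ ⦃a b : V⦄ (α : Path a b), ∃ (d : V) (δ : Path b d), ∀ γ ∈ U,
    (∃ w, γ.rngObj = ofConcat (α.comp δ) w) → (∃ w, γ.srcObj = ofConcat (α.comp δ) w) →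
      γ ∈ Arr.unitSpace (BoundaryPath V)

theorem AvoidsIsotropy.mono {U W : Set (Arr (BoundaryPath V))} (hW : AvoidsIsotropy W)
    (h : U ⊆ W) : AvoidsIsotropy U := fun _ _ α => by
  obtain ⟨d, δ, hδ⟩ := hW α
  exact ⟨d, δ, fun γ hγ => hδ γ (h hγ)⟩

theorem AvoidsIsotropy.union {U W : Set (Arr (BoundaryPath V))} (hU : AvoidsIsotropy U)
    (hW : AvoidsIsotropy W) : AvoidsIsotropy (U ∪ W) := fun _ _ α => by
  obtain ⟨d, δ, hδ⟩ := hU α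
  obtain ⟨d', δ', hδ'⟩ := hW (α.comp δ)
  refine ⟨d', δ.comp δ', ?_⟩
  rw [← Path.comp_assoc]
  rintro γ (hγ | hγ) ⟨w, hw⟩ ⟨w', hw'⟩
  · exact hδ γ hγ ⟨_, hw.trans (ofConcat_comp _ _ _)⟩ ⟨_, hw'.trans (ofConcat_comp _ _ _)⟩
  · exact hδ' γ hγ ⟨w, hw⟩ ⟨w', hw'⟩

theorem mem_unitSpace_of_degree_eq_zero {γ : Arr (BoundaryPath V)} (h : γ.rngObj = γ.srcObj)
    (h' : degree γ = 0) : γ ∈ Arr.unitSpace (BoundaryPath V) :=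
  ⟨γ.rngObj, arr_ext rfl (by rw [degree_one, h']) h⟩

theorem inv_mem_cylinder {a b c : V} {α : Path a c} {β : Path b c} {γ : Arr (BoundaryPath V)}
    (h : γ ∈ cylinder α β) : γ.inv ∈ cylinder β α := by
  obtain ⟨w, h1, h2, h3⟩ := h
  exact ⟨w, h3, by rw [degree_inv]; omega, h1⟩

/-- Isotropy at a boundary path that ends in a sink is trivial. -/
theorem mem_unitSpace_of_sink {a b : V} (β : Path a b) (hb : IsEmpty (Star b))
    {γ : Arr (BoundaryPath V)} (h1 : ∃ w, γ.rngObj = ofConcat β w)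
    (h2 : ∃ w, γ.srcObj = ofConcat β w) : γ ∈ Arr.unitSpace (BoundaryPath V) := by
  have hs : IsSingularVertex b := Or.inl hb
  have huniq : ∀ w : BoundaryPathFrom b, w = .fin Path.nil hs := by
    intro w
    obtain ⟨_, h⟩ | ⟨t, e, y, -⟩ := w.eq_fin_nil_or_cons
    · exact h
    · exact (hb.false ⟨t, e⟩).elim
  obtain ⟨w, hw⟩ := h1
  obtain ⟨w', hw'⟩ := h2
  obtain rfl := huniq w
  obtain rfl := huniq w'
  refine mem_unitSpace_of_degree_eq_zero (hw.trans hw'.symm) ?_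
  have key : ∀ {a₁ a₂ c : V} (μ : Path a₁ c) (ν : Path a₂ c) (y : BoundaryPathFrom c),
      ofConcat μ y = ofConcat β (.fin Path.nil hs) → ofConcat μ y = ofConcat ν y →
      μ.length ≤ ν.length → μ.length = ν.length := by
    intro a₁ a₂ c μ ν y e e' hl
    obtain ⟨rfl, ζ, rfl, h⟩ := ofConcat_eq e' hl
    cases y with
    | fin p hp =>
      have := length_eq_zero_of_concat_fin h
      simp [this]
    | inf q hq hc =>
      obtain ⟨_, _, _, h'⟩ := BoundaryPathFrom.concat_inf μ q hq hc
      injection e with e1 e2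
      subst e1
      have e3 := eq_of_heq e2
      rw [h', BoundaryPathFrom.concat_fin] at e3
      cases e3
  obtain ⟨a₁, a₂, c, μ, ν, y, k1, k2, k3⟩ := exists_mem_cylinder γ
  have e : ofConcat μ y = ofConcat ν y := k1.symm.trans (hw.trans (hw'.symm.trans k3))
  rw [k2, sub_eq_zero, Nat.cast_inj]
  rcases le_total μ.length ν.length with hl | hl
  · exact key μ ν y (k1.symm.trans hw) e hl
  · exact (key ν μ y (k3.symm.trans hw') e.symm hl).symm

/-- If the set `Z(μ, ν)` with `|ν| < |μ|` contains an arrow with both ends in `Z(α)` for a long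
path `α`, then a closed path starts at `r(α)`, and `α` can be extended off the powers of this
closed path. -/
theorem exists_extension_of_length_lt (hL : ∀ (a : V) (p : Path a a), IsCycle p → HasExit p)
    {a₁ a₂ c a b : V} (μ : Path a₁ c) (ν : Path a₂ c) (hνμ : ν.length < μ.length) (α : Path a b)
    (hα : μ.length ≤ α.length) :
    ∃ (d : V) (δ : Path b d), ∀ γ ∈ cylinder μ ν, (∃ w, γ.rngObj = ofConcat (α.comp δ) w) →
      (∃ w, γ.srcObj = ofConcat (α.comp δ) w) → False := by
  by_cases hex : ∃ γ ∈ cylinder μ ν, (∃ w, γ.rngObj = ofConcat α w) ∧ ∃ w, γ.srcObj = ofConcat α w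
  · obtain ⟨γ, ⟨w, h1, -, h3⟩, ⟨u, hu⟩, ⟨u', hu'⟩⟩ := hex
    obtain ⟨rfl, τ, rfl, hw⟩ := ofConcat_eq (h1.symm.trans hu) hα
    obtain ⟨rfl, σ, hσ, hw'⟩ := ofConcat_eq (h3.symm.trans hu') (hνμ.le.trans hα)
    dsimp only at hσ
    have hlen := congrArg Path.length hσ
    simp only [Path.length_comp] at hlen
    -- Here `α = μτ = ντη`, so `η` is a closed path at `r(α)` of length `|μ| - |ν| > 0`.
    obtain ⟨η, rfl, -⟩ := BoundaryPathFrom.prefix_of_concat_eq τ σ u u' (hw.symm.trans hw')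
      (by omega)
    rw [Path.length_comp] at hlen
    obtain ⟨d, δ, hδ⟩ := exists_path_of_forall_loop hL η (by omega)
    refine ⟨d, δ, ?_⟩
    rintro γ' ⟨y, k1, -, k3⟩ ⟨v, hv⟩ ⟨v', hv'⟩
    have e1 : y = .concat τ (.concat δ v) := by
      apply ofConcat_injective μ
      dsimp only at hv
      rw [← k1, hv, Path.comp_assoc, ofConcat_comp, BoundaryPathFrom.concat_comp]
    have e2 : y = .concat τ (.concat η (.concat δ v')) := by
      apply ofConcat_injective ν
      dsimp only at hv'
      rw [← k3, hv', hσ, Path.comp_assoc, ofConcat_comp, BoundaryPathFrom.concat_comp,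
        BoundaryPathFrom.concat_comp]
    exact hδ v v' (BoundaryPathFrom.concat_injective τ (e1.symm.trans e2))
  · exact ⟨b, Path.nil, fun γ hγ h1 h2 => hex ⟨γ, hγ, h1, h2⟩⟩

theorem avoidsIsotropy_cylinder (hL : ∀ (a : V) (p : Path a a), IsCycle p → HasExit p)
    {a₁ a₂ c : V} (μ : Path a₁ c) (ν : Path a₂ c) : AvoidsIsotropy (cylinder μ ν) := by
  intro a b α
  -- Below `α` lies a sink, or else paths can be prolonged until `μ` and `ν` are prefixes.
  by_cases hsink : ∃ (d : V) (_ : Path b d), IsEmpty (Star d)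
  · obtain ⟨d, δ, hd⟩ := hsink
    exact ⟨d, δ, fun γ _ h1 h2 => mem_unitSpace_of_sink (α.comp δ) hd h1 h2⟩
  · simp only [not_exists, not_isEmpty_iff] at hsink
    obtain ⟨b', ε, hε⟩ := exists_path_length_eq hsink (μ.length + ν.length)
    rcases lt_trichotomy ν.length μ.length with hl | hl | hl
    · obtain ⟨d, δ, hδ⟩ := exists_extension_of_length_lt hL μ ν hl (α.comp ε) (by simp; omega)
      refine ⟨d, ε.comp δ, fun γ hγ h1 h2 => ?_⟩
      rw [← Path.comp_assoc] at h1 h2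
      exact (hδ γ hγ h1 h2).elim
    · refine ⟨b', ε, ?_⟩
      rintro γ ⟨y, h1, h2, h3⟩ ⟨w, hw⟩ ⟨w', hw'⟩
      have hle : μ.length ≤ (α.comp ε).length := by simp; omega
      generalize α.comp ε = β at hw hw' hle
      obtain ⟨rfl, τ, rfl, -⟩ := ofConcat_eq (h1.symm.trans hw) hle
      obtain ⟨rfl, σ, hσ, -⟩ := ofConcat_eq (h3.symm.trans hw') (hl.le.trans hle)
      obtain ⟨rfl, -⟩ := (Path.comp_inj' hl.symm).1 hσ
      exact mem_unitSpace_of_degree_eq_zero (h1.trans h3.symm) (by omega)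
    · obtain ⟨d, δ, hδ⟩ := exists_extension_of_length_lt hL ν μ hl (α.comp ε) (by simp; omega)
      refine ⟨d, ε.comp δ, fun γ hγ h1 h2 => ?_⟩
      rw [← Path.comp_assoc] at h1 h2
      exact (hδ γ.inv (inv_mem_cylinder hγ) h2 h1).elim

theorem avoidsIsotropy_of_isCompact (hL : ∀ (a : V) (p : Path a a), IsCycle p → HasExit p)
    {U : Set (Arr (BoundaryPath V))} (hU : IsCompact U) : AvoidsIsotropy U := by
  refine hU.induction_on (p := AvoidsIsotropy) ?_ (fun _ _ h hW => hW.mono h)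
    (fun _ _ h h' => h.union h') fun γ _ => ?_
  · exact fun a b α => ⟨b, Path.nil, fun γ hγ => hγ.elim⟩
  · obtain ⟨a, b, c, μ, ν, h⟩ := exists_mem_cylinder γ
    exact ⟨_, mem_nhdsWithin_of_mem_nhds ((isOpen_cylinder μ ν).mem_nhds h),
      avoidsIsotropy_cylinder hL μ ν⟩

variable {S : Type w} [CommSemiring S]

theorem avoidsIsotropy_support (hL : ∀ (a : V) (p : Path a a), IsCycle p → HasExit p)
    {f : Arr (BoundaryPath V) → S} (hf : f ∈ steinbergSubmodule S (BoundaryPath V)) :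
    AvoidsIsotropy (Function.support f) := by
  induction hf using Submodule.span_induction with
  | mem f hf =>
    obtain ⟨U, hU, rfl⟩ := hf
    exact (avoidsIsotropy_of_isCompact hL hU.2).mono Set.support_indicator_subset
  | zero => exact fun a b α => ⟨b, Path.nil, fun γ hγ => (hγ rfl).elim⟩
  | add f g _ _ hf hg => exact (hf.union hg).mono (Function.support_add f g)
  | smul c f _ hf => exact hf.mono (Function.support_const_smul_subset c f)

end Effective

/-! ### Congruences on the Steinberg algebra of the graph groupoid -/

section GraphCongruences

open Quiver BoundaryPath SteinbergAlgebra

variable {V : Type u} [Quiver.{v} V]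

theorem cylinder_mem_compactOpenBisections {a b c : V} (α : Path a c) (β : Path b c) :
    cylinder α β ∈ Arr.compactOpenBisections (BoundaryPath V) := by
  rw [← cylinderDiff_empty]
  exact ⟨isOpenBisection_cylinderDiff α β ∅, isCompact_cylinderDiff α β ∅⟩

theorem cylinder_self_subset_unitSpace {a c : V} (α : Path a c) :
    cylinder α α ⊆ Arr.unitSpace (BoundaryPath V) := by
  rintro γ ⟨w, h1, h2, h3⟩
  exact mem_unitSpace_of_degree_eq_zero (h1.trans h3.symm) (by omega)

theorem one_mem_cylinder_iff {a c : V} {α : Path a c} {x : BoundaryPath V} :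
    Arr.one x ∈ cylinder α α ↔ ∃ w, x = ofConcat α w :=
  ⟨fun ⟨w, h, _⟩ => ⟨w, h⟩, by rintro ⟨w, rfl⟩; exact one_mem_cylinder α w⟩

/-- The sets `Z(α, α)` form a π-base of the unit space. -/
theorem exists_cylinder_subset {W : Set (Arr (BoundaryPath V))} (hW : IsOpen W)
    {x : BoundaryPath V} (hx : Arr.one x ∈ W) :
    ∃ (a c : V) (α : Path a c), cylinder α α ⊆ W := by
  obtain ⟨d, δ, F, h1, h2⟩ := exists_cylinderDiff_subset hW hx (mem_cylinder_nil x)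
  rw [Path.nil_comp] at h1 h2
  obtain ⟨w, -, -, -, hF⟩ := mem_cylinderDiff.1 h1
  have key : F = ∅ ∨ ∃ e : Star d, e ∉ F := by
    obtain ⟨h | h, -⟩ | ⟨t, e, y, rfl⟩ := w.eq_fin_nil_or_cons
    · exact Or.inl (Finset.eq_empty_of_isEmpty F)
    · exact Or.inr (Infinite.exists_notMem_finset F)
    · exact Or.inr ⟨⟨t, e⟩, fun he => hF _ he y rfl⟩
  rcases key with rfl | ⟨e, he⟩
  · exact ⟨_, _, δ, by rwa [cylinderDiff_empty] at h2⟩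
  · refine ⟨_, _, δ.cons e.2, Set.Subset.trans ?_ h2⟩
    rintro γ ⟨y, k1, k2, k3⟩
    refine mem_cylinderDiff.2 ⟨.cons e.2 y, k1, by simpa using k2, k3, fun f hf w' hw' => he ?_⟩
    obtain rfl : e = f := BoundaryPathFrom.cons_edge_inj hw'
    exact hf

theorem setMul_cylinder {a b c d : V} (α : Path a d) (β : Path b d) (γ : Path c d) :
    Arr.setMul (cylinder α β) (cylinder β γ) = cylinder α γ := by
  ext g
  constructor
  · rintro ⟨g₁, ⟨w, h1, h2, h3⟩, g₂, ⟨w', k1, k2, k3⟩, e, rfl⟩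
    obtain rfl : w = w' := ofConcat_injective β (h3.symm.trans (e.trans k1))
    exact ⟨w, h1, by rw [degree_comp]; omega, k3⟩
  · rintro ⟨w, h1, h2, h3⟩
    refine ⟨_, mkArr_mem α β w, _, mkArr_mem β γ w, rfl, arr_ext h1.symm ?_ h3.symm⟩
    refine (degree_comp _).trans ?_
    rw [h2]
    exact sub_add_sub_cancel _ _ _

theorem setMul_unit_left {W U : Set (Arr (BoundaryPath V))}
    (hW : W ⊆ Arr.unitSpace (BoundaryPath V)) (hU : ∀ γ ∈ U, Arr.one γ.rngObj ∈ W) :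
    Arr.setMul W U = U := by
  ext γ
  constructor
  · rintro ⟨α, hα, β, hβ, h, rfl⟩
    obtain ⟨x, rfl⟩ := hW hα
    have : (Arr.one x).comp β h = β := Arr.one_comp (x := x) h
    rwa [this]
  · exact fun hγ => ⟨_, hU γ hγ, γ, hγ, rfl, Arr.one_comp rfl⟩

variable {S : Type w} [CommSemiring S]

variable (S) in
/-- The element `1_{Z(α, β)}` of the Steinberg algebra. -/
noncomputable def cylinderFun {a b c : V} (α : Path a c) (β : Path b c) :
    SteinbergAlgebra S (BoundaryPath V) :=
  charFun S (cylinder α β) (cylinder_mem_compactOpenBisections α β)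

theorem cylinderFun_mul {a b c d : V} (α : Path a d) (β : Path b d) (γ : Path c d) :
    cylinderFun S α β * cylinderFun S β γ = cylinderFun S α γ := by
  rw [cylinderFun, cylinderFun, charFun_mul]
  simp only [setMul_cylinder]
  rfl

theorem cylinderFun_apply {a b c : V} {α : Path a c} {β : Path b c}
    {γ : Arr (BoundaryPath V)} (hγ : γ ∈ cylinder α β) : (cylinderFun S α β).1 γ = 1 :=
  Set.indicator_of_mem hγ 1

theorem cylinderFun_apply_of_notMem {a b c : V} {α : Path a c} {β : Path b c}
    {γ : Arr (BoundaryPath V)} (hγ : γ ∉ cylinder α β) : (cylinderFun S α β).1 γ = 0 :=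
  Set.indicator_of_notMem hγ 1

theorem cylinderFun_ne_zero [Nontrivial S] {a b c : V} (α : Path a c) (β : Path b c) :
    cylinderFun S α β ≠ 0 := fun h => by
  have w : BoundaryPathFrom c := Classical.arbitrary _
  have := cylinderFun_apply (S := S) (mkArr_mem α β w)
  rw [h] at this
  exact zero_ne_one this

theorem SteinbergAlgebra.sum_apply {ι : Type*} (s : Finset ι)
    (f : ι → SteinbergAlgebra S (BoundaryPath V)) (γ : Arr (BoundaryPath V)) :
    (∑ i ∈ s, f i).1 γ = ∑ i ∈ s, (f i).1 γ := by
  classical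
  induction s using Finset.induction_on with
  | empty => rfl
  | insert i s hi ih =>
    rw [Finset.sum_insert hi, Finset.sum_insert hi, ← ih]
    rfl

/-- The vertices `v` with `1_{Z(v)}` congruent to `0`. -/
def nullVertices (ρ : RingCon (SteinbergAlgebra S (BoundaryPath V))) : Set V :=
  {a | ρ (cylinderFun S (Path.nil : Path a a) Path.nil) 0}


theorem rel_zero_left {ρ : RingCon (SteinbergAlgebra S (BoundaryPath V))}
    {f : SteinbergAlgebra S (BoundaryPath V)} (h : ρ f 0)
    (g : SteinbergAlgebra S (BoundaryPath V)) :
    ρ (f * g) 0 := by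
  simpa using ρ.mul h (ρ.refl g)

theorem rel_zero_right {ρ : RingCon (SteinbergAlgebra S (BoundaryPath V))}
    {f : SteinbergAlgebra S (BoundaryPath V)} (h : ρ f 0)
    (g : SteinbergAlgebra S (BoundaryPath V)) :
    ρ (g * f) 0 := by
  simpa using ρ.mul (ρ.refl g) h

theorem mem_nullVertices_of_cylinderFun {ρ : RingCon (SteinbergAlgebra S (BoundaryPath V))}
    {a c : V} {α : Path a c} (h : ρ (cylinderFun S α α) 0) : c ∈ nullVertices ρ := by
  have := rel_zero_right (rel_zero_left h (cylinderFun S α Path.nil)) (cylinderFun S Path.nil α)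
  rwa [cylinderFun_mul, cylinderFun_mul] at this

theorem cylinderFun_rel_zero {ρ : RingCon (SteinbergAlgebra S (BoundaryPath V))}
    {a b c : V} (hc : c ∈ nullVertices ρ) (α : Path a c) (β : Path b c) :
    ρ (cylinderFun S α β) 0 := by
  have := rel_zero_right (rel_zero_left hc (cylinderFun S Path.nil β)) (cylinderFun S α Path.nil)
  rwa [cylinderFun_mul, cylinderFun_mul] at this

theorem isHereditary_nullVertices (ρ : RingCon (SteinbergAlgebra S (BoundaryPath V))) :
    IsHereditary (nullVertices ρ) := by
  intro a b e ha
  have h := rel_zero_left ha (cylinderFun S e.toPath e.toPath)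
  refine mem_nullVertices_of_cylinderFun (α := e.toPath) ?_
  convert h using 1
  rw [cylinderFun, cylinderFun, charFun_mul]
  congr 1
  refine (setMul_unit_left (cylinder_self_subset_unitSpace _) ?_).symm
  rintro γ ⟨w, h1, -, -⟩
  exact one_mem_cylinder_iff.2 ⟨_, h1⟩

/-- The relation `1_{Z(a)} = ∑ 1_{Z(e)}`, where `e` runs over the edges starting at a regular
vertex `a`. -/
theorem cylinderFun_nil_eq_sum {a : V} (ha : Nonempty (Star a)) [Fintype (Star a)] :
    cylinderFun S (Path.nil : Path a a) Path.nil =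
      ∑ e : Star a, cylinderFun S e.2.toPath e.2.toPath := by
  refine Subtype.ext (funext fun γ => ?_)
  rw [SteinbergAlgebra.sum_apply]
  by_cases hγ : γ ∈ cylinder (Path.nil : Path a a) Path.nil
  · rw [cylinderFun_apply hγ]
    obtain ⟨w, h1, h2, h3⟩ := hγ
    obtain ⟨h | h, -⟩ | ⟨t, e, y, rfl⟩ := w.eq_fin_nil_or_cons
    · exact (not_isEmpty_of_nonempty _ h).elim
    · exact (not_finite (Star a)).elim
    · rw [Finset.sum_eq_single ⟨t, e⟩]
      · exact (cylinderFun_apply ⟨y, h1, by simpa using h2, h3⟩).symm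
      · rintro f - hf
        refine cylinderFun_apply_of_notMem fun ⟨y', k1, _, _⟩ => hf ?_
        exact BoundaryPathFrom.cons_edge_inj (ofConcat_injective Path.nil (k1.symm.trans h1))
      · exact fun h => (h (Finset.mem_univ _)).elim
  · rw [cylinderFun_apply_of_notMem hγ, Finset.sum_eq_zero]
    rintro e -
    refine cylinderFun_apply_of_notMem fun h => hγ ?_
    have := cylinder_comp_subset (Path.nil : Path a a) (Path.nil : Path a a) e.2.toPath
    rw [Path.nil_comp] at this
    exact this h

theorem isSaturated_nullVertices (ρ : RingCon (SteinbergAlgebra S (BoundaryPath V))) :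
    IsSaturated (nullVertices ρ) := by
  intro a ha h
  have := ha.2
  have := Fintype.ofFinite (Star a)
  change ρ _ _
  rw [cylinderFun_nil_eq_sum ha.1]
  have key := ρ.finsetSum Finset.univ (f := fun e : Star a => cylinderFun S e.2.toPath e.2.toPath)
    (g := fun _ => 0) fun e _ => cylinderFun_rel_zero (h e.1 e.2) _ _
  rwa [Finset.sum_const_zero] at key

theorem exists_finset_start (f : SteinbergAlgebra S (BoundaryPath V)) :
    ∃ F : Finset V, ∀ γ, f.1 γ ≠ 0 → γ.srcObj.start ∈ F := by
  classical
  obtain ⟨f, hf⟩ := f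
  induction hf using Submodule.span_induction with
  | mem f hf =>
    obtain ⟨U, hU, rfl⟩ := hf
    suffices h : ∃ F : Finset V, ∀ γ ∈ U, γ.srcObj.start ∈ F by
      obtain ⟨F, hF⟩ := h
      exact ⟨F, fun γ hγ => hF γ (Set.mem_of_indicator_ne_zero hγ)⟩
    refine hU.2.induction_on (p := fun U => ∃ F : Finset V, ∀ γ ∈ U, γ.srcObj.start ∈ F)
      ⟨∅, fun _ h => h.elim⟩ ?_ ?_ ?_
    · rintro s t hst ⟨F, hF⟩
      exact ⟨F, fun γ hγ => hF γ (hst hγ)⟩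
    · rintro s t ⟨F, hF⟩ ⟨G, hG⟩
      refine ⟨F ∪ G, fun γ hγ => Finset.mem_union.2 (hγ.imp (hF γ) (hG γ))⟩
    · intro γ _
      obtain ⟨a, b, c, α, β, h⟩ := exists_mem_cylinder γ
      refine ⟨_, mem_nhdsWithin_of_mem_nhds ((isOpen_cylinder α β).mem_nhds h), {b}, ?_⟩
      rintro γ' ⟨w, -, -, h3⟩
      rw [h3]
      exact Finset.mem_singleton_self b
  | zero => exact ⟨∅, fun γ hγ => (hγ rfl).elim⟩
  | add f g hf hg ihf ihg =>
    obtain ⟨F, hF⟩ := ihf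
    obtain ⟨G, hG⟩ := ihg
    refine ⟨F ∪ G, fun γ hγ => Finset.mem_union.2 ?_⟩
    by_cases h : f γ = 0
    · refine Or.inr (hG γ fun h' => hγ ?_)
      change f γ + g γ = 0
      rw [h, show g γ = 0 from h', add_zero]
    · exact Or.inl (hF γ h)
  | smul c f hf ih =>
    obtain ⟨F, hF⟩ := ih
    exact ⟨F, fun γ hγ => hF γ fun h =>
      hγ (show c * f γ = 0 by rw [show f γ = 0 from h, mul_zero])⟩

/-- The finite sums of the idempotents `1_{Z(a)}` are local units. -/
theorem exists_eq_sum_mul_cylinderFun (f : SteinbergAlgebra S (BoundaryPath V)) :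
    ∃ F : Finset V, f = ∑ a ∈ F, f * cylinderFun S (Path.nil : Path a a) Path.nil := by
  classical
  obtain ⟨F, hF⟩ := exists_finset_start f
  refine ⟨F, Subtype.ext (funext fun γ => ?_)⟩
  rw [SteinbergAlgebra.sum_apply]
  have hval : ∀ a : V, (f * cylinderFun S (Path.nil : Path a a) Path.nil).1 γ =
      if γ.srcObj.start = a then f.1 γ else 0 := by
    intro a
    refine (convolution_indicator_unit_right (cylinder_self_subset_unitSpace _) f.1 γ).trans ?_
    congr 1
    rw [one_mem_cylinder_iff]
    refine propext ⟨fun ⟨w, h⟩ => h ▸ rfl, ?_⟩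
    rintro rfl
    exact ⟨γ.srcObj.path, rfl⟩
  simp only [hval]
  rw [Finset.sum_ite_eq]
  split_ifs with h
  · rfl
  · by_contra hne
    exact h (hF γ hne)

theorem rel_of_nullVertices_eq_univ {ρ : RingCon (SteinbergAlgebra S (BoundaryPath V))}
    (h : nullVertices ρ = Set.univ) (f g : SteinbergAlgebra S (BoundaryPath V)) : ρ f g := by
  have key : ∀ f : SteinbergAlgebra S (BoundaryPath V), ρ f 0 := by
    intro f
    obtain ⟨F, hF⟩ := exists_eq_sum_mul_cylinderFun f
    rw [hF]
    have key := ρ.finsetSum F (f := fun a : V => f * cylinderFun S (Path.nil : Path a a) Path.nil)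
      (g := fun _ => 0) fun a _ => rel_zero_right (h ▸ Set.mem_univ a : a ∈ nullVertices ρ) f
    rwa [Finset.sum_const_zero] at key
  exact ρ.trans (key f) (ρ.symm (key g))

/-- An element that is constant on the units in `Z(β)` and vanishes on the other arrows with both
ends in `Z(β)` has a multiple of `1_{Z(β)}` as its corner. -/
theorem cylinderFun_mul_mul_cylinderFun {a b : V} (β : Path a b)
    (f : SteinbergAlgebra S (BoundaryPath V)) (c : S) (hc : ∀ γ ∈ cylinder β β, f.1 γ = c)
    (hf : ∀ γ, f.1 γ ≠ 0 → (∃ w, γ.rngObj = ofConcat β w) → (∃ w, γ.srcObj = ofConcat β w) →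
      γ ∈ Arr.unitSpace (BoundaryPath V)) :
    cylinderFun S β β * (f * cylinderFun S β β) = c • cylinderFun S β β := by
  classical
  refine Subtype.ext (funext fun γ => ?_)
  have hunit := cylinder_self_subset_unitSpace (V := V) β
  refine (convolution_indicator_unit_left hunit (f * cylinderFun S β β).1 γ).trans ?_
  have h2 : (f * cylinderFun S β β).1 γ = _ := convolution_indicator_unit_right hunit f.1 γ
  rw [h2, ← ite_and]
  change _ = c * (cylinderFun S β β).1 γ
  by_cases hγ : γ ∈ cylinder β β
  · rw [cylinderFun_apply hγ, mul_one, if_pos, hc γ hγ]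
    obtain ⟨w, h1, -, h3⟩ := hγ
    exact ⟨one_mem_cylinder_iff.2 ⟨w, h1⟩, one_mem_cylinder_iff.2 ⟨w, h3⟩⟩
  · rw [cylinderFun_apply_of_notMem hγ, mul_zero]
    split_ifs with h
    · by_contra hne
      obtain ⟨x, rfl⟩ := hf γ hne (one_mem_cylinder_iff.1 h.1) (one_mem_cylinder_iff.1 h.2)
      exact hγ h.1
    · rfl

/-- If every cycle has an exit, a congruence that is not trivial identifies some `1_{Z(a)}`
with `0`. -/
theorem nullVertices_nonempty (hS : IsFieldSemiring S ∨ Nonempty (S ≃+* BooleanSemifield))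
    (hL : ∀ (a : V) (p : Path a a), IsCycle p → HasExit p)
    {ρ : RingCon (SteinbergAlgebra S (BoundaryPath V))} {f g : SteinbergAlgebra S (BoundaryPath V)}
    (hρ : ρ f g) (hfg : f ≠ g) : (nullVertices ρ).Nonempty := by
  obtain ⟨γ, hγ⟩ : ∃ γ, f.1 γ ≠ g.1 γ := by
    by_contra! h
    exact hfg (Subtype.ext (funext h))
  obtain ⟨a, b, c, μ, ν, hμν⟩ := exists_mem_cylinder γ
  -- Translation by the bisection `Z(ν, μ)` moves the difference from `γ` to a unit.
  have hval : ∀ f : SteinbergAlgebra S (BoundaryPath V),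
      (cylinderFun S ν μ * f).1 (Arr.one γ.srcObj) = f.1 γ := by
    intro f
    rw [← Arr.inv_comp_self]
    exact convolution_indicator_left _
      (cylinder_mem_compactOpenBisections ν μ).1.injOn_range f.1 (inv_mem_cylinder hμν) rfl
  have hρ' := ρ.mul (ρ.refl (cylinderFun S ν μ)) hρ
  rw [← hval f, ← hval g] at hγ
  generalize cylinderFun S ν μ * f = f' at hγ hρ'
  generalize cylinderFun S ν μ * g = g' at hγ hρ'
  obtain ⟨a', b', α, hα⟩ := exists_cylinder_subset
    (((isLocallyConstant_of_mem_steinbergSubmodule f'.2).isOpen_fiber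
      (f'.1 (Arr.one γ.srcObj))).inter
      ((isLocallyConstant_of_mem_steinbergSubmodule g'.2).isOpen_fiber
        (g'.1 (Arr.one γ.srcObj)))) ⟨rfl, rfl⟩
  obtain ⟨d, δ, hδ⟩ := ((avoidsIsotropy_support hL f'.2).union (avoidsIsotropy_support hL g'.2)) α
  have hsub := (cylinder_comp_subset α α δ).trans hα
  have key := ρ.mul (ρ.refl (cylinderFun S (α.comp δ) (α.comp δ)))
    (ρ.mul hρ' (ρ.refl (cylinderFun S (α.comp δ) (α.comp δ))))
  rw [cylinderFun_mul_mul_cylinderFun _ _ _ (fun γ' h => (hsub h).1) fun γ' h => hδ γ' (Or.inl h),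
    cylinderFun_mul_mul_cylinderFun _ _ _ (fun γ' h => (hsub h).2) fun γ' h => hδ γ' (Or.inr h)]
    at key
  exact ⟨d, mem_nullVertices_of_cylinderFun
    (rel_zero_of_rel_smul hS ρ _ (setMul_cylinder _ _ _) hγ key)⟩

/-! ### Necessity of the conditions -/

theorem simple_of_simple_steinbergAlgebra [Nonempty V]
    (h : ∀ ρ : RingCon (SteinbergAlgebra S (BoundaryPath V)),
      (∀ f g, ρ f g ↔ f = g) ∨ ∀ f g, ρ f g)
    (ρ : RingCon S) : (∀ a b, ρ a b ↔ a = b) ∨ ∀ a b, ρ a b := by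
  obtain ⟨v⟩ := ‹Nonempty V›
  have w : BoundaryPathFrom v := Classical.arbitrary _
  have hmem := one_mem_cylinder Path.nil w
  have hval : ∀ s : S,
      (s • cylinderFun S (Path.nil : Path v v) Path.nil).1 (Arr.one (ofConcat Path.nil w)) = s := by
    intro s
    change s * (cylinderFun S (Path.nil : Path v v) Path.nil).1 _ = s
    rw [cylinderFun_apply hmem, mul_one]
  rcases h (restrictCon ρ Set.univ fun _ _ => trivial) with h | h
  · refine Or.inl fun a b => ⟨fun hab => ?_, fun hab => hab ▸ ρ.refl a⟩
    have := (h (a • cylinderFun S (Path.nil : Path v v) Path.nil)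
      (b • cylinderFun S (Path.nil : Path v v) Path.nil)).1 fun γ _ => ρ.mul hab (ρ.refl _)
    rw [← hval a, this, hval b]
  · refine Or.inr fun a b => ?_
    have := h (a • cylinderFun S (Path.nil : Path v v) Path.nil)
      (b • cylinderFun S (Path.nil : Path v v) Path.nil) (Arr.one (ofConcat Path.nil w)) trivial
    rwa [hval a, hval b] at this

/-- The boundary paths that never enter a set of vertices. -/
def avoidingPaths (H : Set V) : Set (BoundaryPath V) :=
  {x | ∀ (a b : V) (p : Path a b) (w : BoundaryPathFrom b), x = ofConcat p w → b ∉ H}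

theorem srcObj_mem_avoidingPaths {H : Set V} (hH : IsHereditary H) (γ : Arr (BoundaryPath V))
    (hγ : γ.rngObj ∈ avoidingPaths H) : γ.srcObj ∈ avoidingPaths H := by
  intro a b p w hw hb
  obtain ⟨a₁, a₂, c, μ, ν, y, h1, -, h3⟩ := exists_mem_cylinder γ
  have e := hw.symm.trans h3
  rcases le_total p.length ν.length with hl | hl
  · obtain ⟨rfl, δ, rfl, -⟩ := ofConcat_eq e hl
    exact hγ _ _ μ y h1 (hH.mem_of_path δ hb)
  · obtain ⟨rfl, δ, rfl, rfl⟩ := ofConcat_eq e.symm hl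
    exact hγ _ _ (μ.comp δ) w (h1.trans (ofConcat_comp _ _ _).symm) hb

theorem eq_empty_or_eq_univ_of_simple [Nontrivial S]
    (h : ∀ ρ : RingCon (SteinbergAlgebra S (BoundaryPath V)),
      (∀ f g, ρ f g ↔ f = g) ∨ ∀ f g, ρ f g)
    {H : Set V} (hH : IsHereditary H) (hs : IsSaturated H) : H = ∅ ∨ H = Set.univ := by
  by_contra! hc
  obtain ⟨⟨v, hv⟩, hne⟩ := hc
  obtain ⟨a, ha⟩ := (Set.ne_univ_iff_exists_notMem H).1 hne
  rcases h (restrictCon ⊥ (avoidingPaths H) (srcObj_mem_avoidingPaths hH)) with h | h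
  · refine cylinderFun_ne_zero (S := S) (Path.nil : Path v v) Path.nil ((h _ _).1 fun γ hγ => ?_)
    refine cylinderFun_apply_of_notMem ?_
    rintro ⟨w, h1, -, -⟩
    exact hγ _ _ _ w h1 hv
  · obtain ⟨x, hx⟩ := exists_boundaryPathFrom_avoiding hH hs ha
    have hmem : ofConcat Path.nil x ∈ avoidingPaths H := by
      intro b c p w hw
      obtain rfl : a = b := congrArg start hw
      injection hw with _ hw
      exact hx c p w hw
    have := h (cylinderFun S (Path.nil : Path a a) Path.nil) 0 (Arr.one (ofConcat Path.nil x)) hmem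
    rw [cylinderFun_apply (one_mem_cylinder Path.nil x)] at this
    exact one_ne_zero this

/-- If `p` has no exit, there is only one boundary path `x` starting at `a`, and `Z(p, a)` and
`Z(a, a)` are the singletons of two different arrows from `x` to `x`, which act equally. -/
theorem hasExit_of_simple [Nontrivial S]
    (h : ∀ ρ : RingCon (SteinbergAlgebra S (BoundaryPath V)),
      (∀ f g, ρ f g ↔ f = g) ∨ ∀ f g, ρ f g)
    {a : V} {p : Path a a} (hp : 0 < p.length) : HasExit p := by
  by_contra hex
  have huniq := boundaryPathFrom_eq_of_not_hasExit hp hex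
  have w : BoundaryPathFrom a := Classical.arbitrary _
  have hinj : ∀ q : Path a a, Set.InjOn Arr.range (cylinder q (Path.nil : Path a a)) := fun q =>
    (cylinder_mem_compactOpenBisections q Path.nil).1.injOn_range
  have hact : ∀ (q : Path a a) (φ : BoundaryPath V → S) (x : BoundaryPath V),
      x = ⟨a, w⟩ → orbitAction (cylinderFun S q Path.nil).1 φ x = φ ⟨a, w⟩ := by
    rintro q φ _ rfl
    have := orbitAction_indicator (hinj q) φ (mkArr_mem q Path.nil w)
    rw [show (mkArr q Path.nil w).rngObj = ⟨a, w⟩ from congrArg _ (huniq _ _)] at this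
    exact this
  have hact' : ∀ (q : Path a a) (φ : BoundaryPath V → S) (x : BoundaryPath V),
      x ≠ ⟨a, w⟩ → orbitAction (cylinderFun S q Path.nil).1 φ x = 0 := by
    rintro q φ x hx
    refine orbitAction_indicator_of_notMem φ ?_
    rintro γ ⟨y, h1, -, -⟩ rfl
    exact hx (h1.trans (congrArg (BoundaryPath.mk a) (huniq _ _)))
  have hrel : orbitCon S (BoundaryPath V) (cylinderFun S p Path.nil)
      (cylinderFun S (Path.nil : Path a a) Path.nil) := fun φ => funext fun x => by
    by_cases hx : x = ⟨a, w⟩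
    · rw [hact p φ x hx, hact Path.nil φ x hx]
    · rw [hact' p φ x hx, hact' Path.nil φ x hx]
  rcases h (orbitCon S (BoundaryPath V)) with h | h
  · have h1 := cylinderFun_apply (S := S) (mkArr_mem p Path.nil w)
    rw [(h _ _).1 hrel, cylinderFun_apply_of_notMem] at h1
    · exact zero_ne_one h1
    · rintro ⟨y, -, k2, -⟩
      change (p.length : ℤ) - 0 = 0 - 0 at k2
      omega
  · have h1 := congrFun (h (cylinderFun S (Path.nil : Path a a) Path.nil) 0 1) ⟨a, w⟩
    rw [hact Path.nil _ _ rfl] at h1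
    refine one_ne_zero (h1.trans ?_)
    exact congrFun (orbitAction_zero _) _

end GraphCongruences

theorem mainTheorem2 {V : Type u} [Quiver.{v} V] [Nonempty V]
    {S : Type w} [CommSemiring S] [Nontrivial S] :
    IsCongruenceSimple (SteinbergAlgebra S (BoundaryPath V)) ↔
      (IsFieldSemiring S ∨ Nonempty (S ≃+* BooleanSemifield)) ∧
      (∀ H : Set V, IsHereditary H → IsSaturated H → H = ∅ ∨ H = Set.univ) ∧
      (∀ (a : V) (p : Quiver.Path a a), IsCycle p → HasExit p) := by
  constructor
  · rintro ⟨-, h⟩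
    exact ⟨isFieldSemiring_or_boolean_of_simple (simple_of_simple_steinbergAlgebra h),
      fun H hH hs => eq_empty_or_eq_univ_of_simple h hH hs, fun a p hp => hasExit_of_simple h hp.1⟩
  · rintro ⟨hS, hV, hL⟩
    obtain ⟨v⟩ := ‹Nonempty V›
    refine ⟨⟨_, 0, cylinderFun_ne_zero (Quiver.Path.nil : Quiver.Path v v) Quiver.Path.nil⟩,
      fun ρ => ?_⟩
    by_cases hρ : ∀ f g, ρ f g → f = g
    · exact Or.inl fun f g => ⟨hρ f g, fun h => h ▸ ρ.refl f⟩
    · push Not at hρ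
      obtain ⟨f, g, hfg, hne⟩ := hρ
      refine Or.inr (rel_of_nullVertices_eq_univ ?_)
      refine (hV _ (isHereditary_nullVertices ρ) (isSaturated_nullVertices ρ)).resolve_left ?_
      exact (nullVertices_nonempty hS hL hfg hne).ne_empty
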